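/- Let $I=[a,b]$ with $a<b$. Let $\mathcal B^2(I)$ be the Bayes space: the set of (a.e.) positive functions $f$ on $I$ with $\log f\in L^2(I)$, up to a.e. equality and multiplication by positive constants, which is a Hilbert space with $f\oplus g=fg$, $r\odot f=f^r$ (so the zero vector is the constant density and $f\ominus g=f/g$) and $$\langle f,g\rangle_{B^2}=\frac1{2(b-a)}\int_I\int_I\log\frac{f(t)}{f(s)}\,\log\frac{g(t)}{g(s)}\,dt\,ds .$$ Put $\mathrm{clr}(f)=\log f-\frac1{b-a}\int_I\log f(t)\,dt\in L^2(I)$, so that $\langle f,g\rangle_{B^2}=\langle\mathrm{clr}(f),\mathrm{clr}(g)\rangle_{L^2}$. For a positive, self-adjoint, compact operator $C$ on $\mathcal B^2(I)$ write $C=\sum_{i\ge1}\lambda_i\,\zeta_i\otimes\zeta_i$ with eigenvalues $\lambda_1\ge\lambda_2\ge\dots\ge0$ (repeated according to multiplicity) and orthonormal eigenvectors $\zeta_i$, and $C^{1/2}=\sum_i\lambda_i^{1/2}\zeta_i\otimes\zeta_i$. For $\alpha>0$ and $k\in\mathbb N_0$ such that $k=0$ or $\lambda_k>\lambda_{k+1}$,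 let $W(k)$ be the orthogonal projection onto the orthogonal complement of $\mathrm{span}\{\zeta_1,\dots,\zeta_k\}$, let $$x^{\alpha,k}_{\mathrm{st},C}=\operatorname*{arg\,min}_{z\in\mathcal B^2(I)}\left\{\|C^{1/2}z\ominus x\|_{B^2}^2+\alpha\|W(k)z\|_{B^2}^2\right\}\qquad(x\in\mathcal B^2(I)),$$ and define the squared regularized Mahalanobis distance $M^2_{\alpha,k,B^2}(x,y;C)=\|x^{\alpha,k}_{\mathrm{st},C}\ominus y^{\alpha,k}_{\mathrm{st},C}\|_{B^2}^2$. Where the operator $C$ has $k\ge1$ and $\lambda_k=\lambda_{k+1}$, put $M^2_{\alpha,k,B^2}(x,y;C)=0$. Let $X$ be a random element of $\mathcal B^2(I)$ such that $\mathrm{clr}(X)$ is a Gaussian random element of $L^2(I)$, with constant Bayes mean, i.e. $\mathbb E\langle X,f\rangle_{B^2}=0$ for all $f\in\mathcal B^2(I)$ (so $\mu_{B^2,X}$ is the zero vector), and Bayes covariance operator $C$, $\langle Cf,g\rangle_{B^2}=\mathbb E\left(\langle X,f\rangle_{B^2}\langle X,g\rangle_{B^2}\right)$ for all $f,g$, with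 eigenvalues $\lambda_1\ge\lambda_2\ge\cdots$. On the probability space of $X$, let $\hat\mu_n$ be random elements of $\mathcal B^2(I)$ and $\hat C_n$ random operators on $\mathcal B^2(I)$ that are almost surely positive, self-adjoint and compact, and suppose that they are strongly consistent: almost surely $\hat\mu_n\to\mu_{B^2,X}$ in $\mathcal B^2(I)$ and $\hat C_n\to C$ in operator norm. Then, for all $\alpha>0$ and $k\in\mathbb N_0$ with $k=0$ or $\lambda_k>\lambda_{k+1}$, $M^2_{\alpha,k,B^2}(X,\hat\mu_n;\hat C_n)$ converges in distribution, as $n\to\infty$, to $M^2_{\alpha,k,B^2}(X)=M^2_{\alpha,k,B^2}(X,\mu_{B^2,X};C)$, and $$M^2_{\alpha,k,B^2}(X)\ \sim\ y+\sum_{i=k+1}^\infty\frac{\lambda_i^2}{(\lambda_i+\alpha)^2}\,\eta_i ,$$ where $\eta_i\sim\chi^2(1)$, $i\ge1$, are mutually independent and independent of $y\sim\chi^2(k)$ (with $y=0$ almost surely for $k=0$), and the series converges almost surely. -/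

import Mathlib

open MeasureTheory ProbabilityTheory Filter Topology Set
open scoped RealInnerProductSpace ENNReal NNReal

noncomputable section

namespace BayesRDMD

/-! ### The Bayes space `B²(I)`, `I = [a, b]` -/

/-- Lebesgue measure on the interval `I = [a, b]`. -/
abbrev lebI (a b : ℝ) : Measure ℝ := volume.restrict (Icc a b)

/-- A positive function (density) on `I = [a, b]` with square-integrable logarithm. -/
structure PosDensity (a b : ℝ) where
  toFun : ℝ → ℝ
  pos : ∀ᵐ t ∂(lebI a b), 0 < toFun t
  memLp_log : MemLp (fun t => Real.log (toFun t)) 2 (lebI a b)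

namespace PosDensity

variable {a b : ℝ}

/-- `f =_B g`: the two densities are proportional (almost everywhere on `I`). -/
def BEq (f g : PosDensity a b) : Prop :=
  ∃ c : ℝ, 0 < c ∧ ∀ᵐ t ∂(lebI a b), f.toFun t = c * g.toFun t

instance setoid (a b : ℝ) : Setoid (PosDensity a b) where
  r := BEq
  iseqv := by
    refine ⟨fun f => ⟨1, one_pos, by simp⟩, ?_, ?_⟩
    · rintro f g ⟨c, hc, h⟩
      refine ⟨c⁻¹, inv_pos.2 hc, ?_⟩
      filter_upwards [h] with t ht
      rw [ht]; field_simp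
    · rintro f g h ⟨c, hc, h1⟩ ⟨d, hd, h2⟩
      refine ⟨c * d, mul_pos hc hd, ?_⟩
      filter_upwards [h1, h2] with t ht1 ht2
      rw [ht1, ht2]; ring

/-- Perturbation: pointwise product of densities. -/
def perturb (f g : PosDensity a b) : PosDensity a b where
  toFun t := f.toFun t * g.toFun t
  pos := by
    filter_upwards [f.pos, g.pos] with t hf hg using mul_pos hf hg
  memLp_log := by
    refine (memLp_congr_ae ?_).2 (f.memLp_log.add g.memLp_log)
    filter_upwards [f.pos, g.pos] with t hf hg
    simp [Real.log_mul hf.ne' hg.ne']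

/-- Powering: pointwise real power of a density. -/
def power (r : ℝ) (f : PosDensity a b) : PosDensity a b where
  toFun t := f.toFun t ^ r
  pos := by
    filter_upwards [f.pos] with t hf using Real.rpow_pos_of_pos hf r
  memLp_log := by
    refine (memLp_congr_ae ?_).2 (f.memLp_log.const_mul r)
    filter_upwards [f.pos] with t hf
    simp [Real.log_rpow hf]

/-- The constant (uniform) density. -/
def unif (a b : ℝ) : PosDensity a b where
  toFun _ := 1
  pos := by simp
  memLp_log := by simp

/-- The centred log-ratio of a density, as a function. -/
def clrFun (f : PosDensity a b) (t : ℝ) : ℝ :=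
  Real.log (f.toFun t) - (b - a)⁻¹ * ∫ s in Icc a b, Real.log (f.toFun s)

lemma memLp_clrFun (f : PosDensity a b) : MemLp f.clrFun 2 (lebI a b) :=
  f.memLp_log.sub (memLp_const _)

/-- The (normalized) double-integral inner product of densities. -/
def innerB (f g : PosDensity a b) : ℝ :=
  (2 * (b - a))⁻¹ * ∫ s in Icc a b, ∫ t in Icc a b,
    Real.log (f.toFun t / f.toFun s) * Real.log (g.toFun t / g.toFun s)

lemma lebI_zero (h : ¬ a < b) : lebI a b = 0 := by
  rw [Measure.restrict_eq_zero, Real.volume_Icc]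
  simp; linarith

lemma clrFun_congr {f g : PosDensity a b} (h : BEq f g) : f.clrFun =ᵐ[lebI a b] g.clrFun := by
  by_cases hab : a < b
  swap
  · rw [lebI_zero hab]; simp [Filter.EventuallyEq]
  obtain ⟨c, hc, h⟩ := h
  have h1 : ∀ᵐ t ∂(lebI a b), Real.log (f.toFun t) = Real.log c + Real.log (g.toFun t) := by
    filter_upwards [h, g.pos] with t ht hg
    rw [ht, Real.log_mul hc.ne' hg.ne']
  have h2 : ∫ s in Icc a b, Real.log (f.toFun s)
      = (b - a) * Real.log c + ∫ s in Icc a b, Real.log (g.toFun s) := by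
    rw [integral_congr_ae h1, integral_add (integrable_const _)
      (g.memLp_log.integrable one_le_two)]
    simp [hab.le]
  filter_upwards [h1] with t ht
  have : b - a ≠ 0 := by linarith
  simp only [clrFun, ht, h2]
  field_simp
  ring

lemma innerB_eq (f g : PosDensity a b) :
    f.innerB g = ∫ t in Icc a b, f.clrFun t * g.clrFun t := by
  by_cases hab : a < b
  swap
  · have := lebI_zero hab
    simp [innerB, lebI] at this ⊢
    simp [this]
  have hF := f.memLp_log
  have hG := g.memLp_log
  set F := fun t => Real.log (f.toFun t) with hFdef
  set G := fun t => Real.log (g.toFun t) with hGdef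
  have iF : Integrable F (lebI a b) := hF.integrable one_le_two
  have iG : Integrable G (lebI a b) := hG.integrable one_le_two
  have iFG : Integrable (fun t => F t * G t) (lebI a b) := hF.integrable_mul hG
  have m0 : b - a ≠ 0 := by linarith
  have c1 : ∀ c : ℝ, ∫ _t in Icc a b, c = (b - a) * c := fun c => by simp [hab.le]
  set IF := ∫ t in Icc a b, F t with hIF
  set IG := ∫ t in Icc a b, G t with hIG
  set IFG := ∫ t in Icc a b, F t * G t with hIFG
  have key : ∀ p q : ℝ, ∫ t in Icc a b, (F t - p) * (G t - q)
      = IFG - q * IF - p * IG + (b - a) * (p * q) := by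
    intro p q
    have e : ∀ t, (F t - p) * (G t - q) = ((F t * G t - q * F t) - p * G t) + p * q :=
      fun t => by ring
    simp_rw [e]
    have i1 : Integrable (fun t => F t * G t - q * F t) (lebI a b) := iFG.sub (iF.const_mul q)
    have i2 : Integrable (fun t => F t * G t - q * F t - p * G t) (lebI a b) :=
      i1.sub (iG.const_mul p)
    rw [integral_add i2 (integrable_const _), integral_sub i1 (iG.const_mul p),
      integral_sub iFG (iF.const_mul q), integral_const_mul, integral_const_mul, c1]
  have inn : ∀ᵐ s ∂(lebI a b), ∫ t in Icc a b,
      Real.log (f.toFun t / f.toFun s) * Real.log (g.toFun t / g.toFun s)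
      = IFG - G s * IF - F s * IG + (b - a) * (F s * G s) := by
    filter_upwards [f.pos, g.pos] with s hs hs'
    rw [← key]
    refine integral_congr_ae ?_
    filter_upwards [f.pos, g.pos] with t ht ht'
    rw [Real.log_div ht.ne' hs.ne', Real.log_div ht'.ne' hs'.ne']
  have outer : ∫ s in Icc a b, (IFG - G s * IF - F s * IG + (b - a) * (F s * G s))
      = 2 * ((b - a) * IFG - IF * IG) := by
    have i1 : Integrable (fun s => IFG - G s * IF) (lebI a b) :=
      (integrable_const _).sub (iG.mul_const _)
    have i2 : Integrable (fun s => IFG - G s * IF - F s * IG) (lebI a b) :=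
      i1.sub (iF.mul_const _)
    rw [integral_add i2 (iFG.const_mul _), integral_sub i1 (iF.mul_const _),
      integral_sub (integrable_const _) (iG.mul_const _), integral_mul_const,
      integral_mul_const, integral_const_mul, c1]
    ring
  rw [innerB, integral_congr_ae inn, outer]
  have := key ((b - a)⁻¹ * IF) ((b - a)⁻¹ * IG)
  simp only [clrFun]
  rw [this]
  field_simp
  ring

lemma innerB_congr {f f' g g' : PosDensity a b} (h : BEq f f') (h' : BEq g g') :
    f.innerB g = f'.innerB g' := by
  rw [innerB_eq, innerB_eq]
  refine integral_congr_ae ?_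
  filter_upwards [clrFun_congr h, clrFun_congr h'] with t ht ht'
  rw [ht, ht']

end PosDensity

/-- The Bayes space `B²(I)`: positive densities on `I = [a, b]` with square-integrable logarithm,
up to proportionality. -/
def BayesSpace (a b : ℝ) : Type := Quotient (PosDensity.setoid a b)

/-- The Hilbert space `L²(I)`. -/
abbrev L2I (a b : ℝ) : Type := Lp ℝ 2 (lebI a b)

/-- `L²(I)` carries its Borel `σ`-algebra. -/
instance (a b : ℝ) : MeasurableSpace (L2I a b) := borel _

instance (a b : ℝ) : BorelSpace (L2I a b) := ⟨rfl⟩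

namespace BayesSpace

variable {a b : ℝ}

/-- The class of a density. -/
def mk (f : PosDensity a b) : BayesSpace a b := Quotient.mk (PosDensity.setoid a b) f

/-- The centred log-ratio transformation `B²(I) → L²(I)`. -/
def clr : BayesSpace a b → L2I a b :=
  Quotient.lift (fun f : PosDensity a b => (PosDensity.memLp_clrFun f).toLp f.clrFun)
    (fun f g h => (MemLp.toLp_eq_toLp_iff (PosDensity.memLp_clrFun f)
      (PosDensity.memLp_clrFun g)).2 (PosDensity.clrFun_congr h))

lemma clr_mk (f : PosDensity a b) : clr (mk f) = (PosDensity.memLp_clrFun f).toLp f.clrFun := rfl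

lemma clr_mk_ae (f : PosDensity a b) : clr (mk f) =ᵐ[lebI a b] f.clrFun :=
  MemLp.coeFn_toLp (PosDensity.memLp_clrFun f)

lemma clr_injective : Function.Injective (clr : BayesSpace a b → L2I a b) := by
  intro x y
  refine Quotient.inductionOn₂ x y ?_
  intro f g h
  have h' := (MemLp.toLp_eq_toLp_iff (PosDensity.memLp_clrFun f) (PosDensity.memLp_clrFun g)).1 h
  refine Quotient.sound ⟨Real.exp ((b - a)⁻¹ * (∫ s in Icc a b, Real.log (f.toFun s))
    - (b - a)⁻¹ * ∫ s in Icc a b, Real.log (g.toFun s)), Real.exp_pos _, ?_⟩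
  filter_upwards [h', f.pos, g.pos] with t ht hf hg
  simp only [PosDensity.clrFun] at ht
  rw [← Real.exp_log hf, ← Real.exp_log hg, ← Real.exp_add]
  congr 1
  linarith

/-- Addition is perturbation `⊕`. -/
instance : Add (BayesSpace a b) where
  add := Quotient.map₂ PosDensity.perturb (by
    rintro f f' ⟨c, hc, h⟩ g g' ⟨d, hd, h'⟩
    refine ⟨c * d, mul_pos hc hd, ?_⟩
    filter_upwards [h, h'] with t ht ht'
    simp only [PosDensity.perturb, ht, ht']
    ring)

/-- Scalar multiplication is powering `⊙`. -/
instance : SMul ℝ (BayesSpace a b) where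
  smul r := Quotient.map (PosDensity.power r) (by
    rintro f f' ⟨c, hc, h⟩
    refine ⟨c ^ r, Real.rpow_pos_of_pos hc r, ?_⟩
    filter_upwards [h, f'.pos] with t ht hp
    simp only [PosDensity.power, ht]
    rw [Real.mul_rpow hc.le hp.le])

/-- The neutral element is the class of the constant density. -/
instance : Zero (BayesSpace a b) := ⟨mk (PosDensity.unif a b)⟩

instance : Neg (BayesSpace a b) := ⟨fun f => (-1 : ℝ) • f⟩
instance : Sub (BayesSpace a b) := ⟨fun f g => f + (-1 : ℝ) • g⟩
instance : SMul ℕ (BayesSpace a b) := ⟨fun n f => (n : ℝ) • f⟩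
instance : SMul ℤ (BayesSpace a b) := ⟨fun n f => (n : ℝ) • f⟩

/-- The inner product of `B²(I)`: the class version of the double-integral inner product. -/
instance : Inner ℝ (BayesSpace a b) where
  inner := Quotient.lift₂ (fun f g : PosDensity a b => f.innerB g)
    (fun _ _ _ _ h h' => PosDensity.innerB_congr h h')

lemma clr_add (x y : BayesSpace a b) : clr (x + y) = clr x + clr y := by
  refine Quotient.inductionOn₂ x y ?_
  intro f g
  change clr (mk (f.perturb g)) = clr (mk f) + clr (mk g)
  rw [clr_mk, clr_mk, clr_mk, ← MemLp.toLp_add, MemLp.toLp_eq_toLp_iff]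
  have h1 : ∀ᵐ t ∂(lebI a b), Real.log ((f.perturb g).toFun t)
      = Real.log (f.toFun t) + Real.log (g.toFun t) := by
    filter_upwards [f.pos, g.pos] with t hf hg using Real.log_mul hf.ne' hg.ne'
  have h2 := integral_congr_ae h1
  rw [integral_add (f.memLp_log.integrable one_le_two) (g.memLp_log.integrable one_le_two)] at h2
  filter_upwards [h1] with t ht
  simp only [PosDensity.clrFun, Pi.add_apply, ht, h2]
  ring

lemma clr_smul (r : ℝ) (x : BayesSpace a b) : clr (r • x) = r • clr x := by
  refine Quotient.inductionOn x ?_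
  intro f
  change clr (mk (f.power r)) = r • clr (mk f)
  rw [clr_mk, clr_mk, ← MemLp.toLp_const_smul, MemLp.toLp_eq_toLp_iff]
  have h1 : ∀ᵐ t ∂(lebI a b), Real.log ((f.power r).toFun t) = r * Real.log (f.toFun t) := by
    filter_upwards [f.pos] with t hf using Real.log_rpow hf r
  have h2 := integral_congr_ae h1
  rw [integral_const_mul] at h2
  filter_upwards [h1] with t ht
  simp only [PosDensity.clrFun, Pi.smul_apply, smul_eq_mul, ht, h2]
  ring

lemma clr_zero : clr (0 : BayesSpace a b) = 0 := by
  change clr (mk (PosDensity.unif a b)) = 0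
  rw [clr_mk, ← MemLp.toLp_zero (MemLp.zero : MemLp (0 : ℝ → ℝ) 2 (lebI a b)),
    MemLp.toLp_eq_toLp_iff]
  refine Eventually.of_forall fun t => ?_
  simp [PosDensity.clrFun, PosDensity.unif]

lemma clr_neg (x : BayesSpace a b) : clr (-x) = -clr x := by
  change clr ((-1 : ℝ) • x) = _
  rw [clr_smul]; simp

lemma clr_sub (x y : BayesSpace a b) : clr (x - y) = clr x - clr y := by
  change clr (x + (-1 : ℝ) • y) = _
  rw [clr_add, clr_smul]; simp [sub_eq_add_neg]

instance : AddCommGroup (BayesSpace a b) :=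
  clr_injective.addCommGroup clr clr_zero clr_add clr_neg clr_sub
    (fun x n => (clr_smul (n : ℝ) x).trans (Nat.cast_smul_eq_nsmul ℝ n (clr x)))
    (fun x n => (clr_smul (n : ℝ) x).trans (Int.cast_smul_eq_zsmul ℝ n (clr x)))

instance : Module ℝ (BayesSpace a b) :=
  clr_injective.module ℝ ⟨⟨clr, clr_zero⟩, clr_add⟩ clr_smul

/-- The clr transformation preserves inner products. -/
lemma inner_eq (x y : BayesSpace a b) : inner ℝ x y = ⟪clr x, clr y⟫ := by
  refine Quotient.inductionOn₂ x y ?_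
  intro f g
  change f.innerB g = ⟪clr (mk f), clr (mk g)⟫
  rw [PosDensity.innerB_eq, L2.inner_def]
  refine integral_congr_ae ?_
  filter_upwards [clr_mk_ae f, clr_mk_ae g] with t hf hg
  rw [hf, hg]
  simp [mul_comm]

/-- The axioms of an inner product. -/
@[reducible]
def core : InnerProductSpace.Core ℝ (BayesSpace a b) where
  inner x y := inner ℝ x y
  conj_inner_symm x y := by
    simp only [inner_eq]
    exact inner_conj_symm (𝕜 := ℝ) _ _
  re_inner_nonneg x := by
    simp only [inner_eq]
    exact inner_self_nonneg (𝕜 := ℝ)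
  add_left x y z := by simp only [inner_eq, clr_add, inner_add_left]
  smul_left x y r := by simp only [inner_eq, clr_smul, inner_smul_left]
  definite x h := by
    simp only [inner_eq] at h
    exact clr_injective ((inner_self_eq_zero.1 h).trans clr_zero.symm)

instance : NormedAddCommGroup (BayesSpace a b) :=
  core.toNormedAddCommGroup

instance : InnerProductSpace ℝ (BayesSpace a b) :=
  InnerProductSpace.ofCore core.toCore

/-- The clr transformation as a linear isometry `B²(I) → L²(I)`. -/
def clrₗᵢ (a b : ℝ) : BayesSpace a b →ₗᵢ[ℝ] L2I a b where
  toFun := clr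
  map_add' := clr_add
  map_smul' := clr_smul
  norm_map' x := by
    change ‖clr x‖ = ‖x‖
    rw [@norm_eq_sqrt_real_inner _ _ _ (clr x), @norm_eq_sqrt_real_inner _ _ _ x]
    exact congrArg Real.sqrt (inner_eq x x).symm

/-- The range of clr consists of the functions with zero integral. -/
lemma range_clr : range (clr : BayesSpace a b → L2I a b)
    = {h : L2I a b | ∫ t in Icc a b, h t = 0} := by
  ext h
  constructor
  · rintro ⟨x, rfl⟩
    refine Quotient.inductionOn x ?_
    intro f
    change ∫ t in Icc a b, clr (mk f) t = 0
    rw [integral_congr_ae (clr_mk_ae f)]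
    by_cases hab : a < b
    · simp only [PosDensity.clrFun]
      rw [integral_sub (f.memLp_log.integrable one_le_two) (integrable_const _)]
      have : b - a ≠ 0 := by linarith
      simp [hab.le]
      field_simp
      ring
    · rw [PosDensity.lebI_zero hab]; simp
  · intro hh
    have hh : ∫ t in Icc a b, h t = 0 := hh
    refine ⟨mk ⟨fun t => Real.exp (h t), Eventually.of_forall fun t => Real.exp_pos _, ?_⟩, ?_⟩
    · simpa using Lp.memLp h
    · refine Lp.ext ?_
      refine (clr_mk_ae _).trans (Eventually.of_forall fun t => ?_)
      simp [PosDensity.clrFun, hh]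

instance : CompleteSpace (BayesSpace a b) := by
  have hc : IsClosed (range (clrₗᵢ a b)) := by
    change IsClosed (range (clr : BayesSpace a b → L2I a b))
    rw [range_clr]
    refine isClosed_eq ?_ continuous_const
    have : ∀ h : L2I a b, ∫ t in Icc a b, h t
        = ⟪(memLp_const (1 : ℝ) : MemLp (fun _ => (1 : ℝ)) 2 (lebI a b)).toLp _, h⟫ := by
      intro h
      rw [L2.inner_def]
      refine integral_congr_ae ?_
      filter_upwards [(memLp_const (1 : ℝ) :
        MemLp (fun _ => (1 : ℝ)) 2 (lebI a b)).coeFn_toLp] with t ht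
      rw [ht]; simp
    simp_rw [this]
    fun_prop
  exact (clrₗᵢ a b).isometry.isUniformInducing.completeSpace hc.isComplete

/-- `B²(I)` carries its Borel `σ`-algebra. -/
instance : MeasurableSpace (BayesSpace a b) := borel _

instance : BorelSpace (BayesSpace a b) := ⟨rfl⟩

end BayesSpace

/-! ### Moments, eigenpairs and the regularized Mahalanobis distance in a Hilbert space -/

section Hilbert

variable {H : Type*} [NormedAddCommGroup H] [InnerProductSpace ℝ H]

/-- `m` is the (Bayes) mean of the random element `X`. -/
def IsMean {Ω : Type*} [MeasurableSpace Ω] (P : Measure Ω) (X : Ω → H) (m : H) : Prop :=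
  ∀ f : H, Integrable (fun ω => ⟪X ω, f⟫) P ∧ ⟪m, f⟫ = ∫ ω, ⟪X ω, f⟫ ∂P

/-- `C` is the (Bayes) covariance operator of the random element `X` with mean `m`. -/
def IsCovariance {Ω : Type*} [MeasurableSpace Ω] (P : Measure Ω) (X : Ω → H) (m : H)
    (C : H →L[ℝ] H) : Prop :=
  ∀ f g : H, Integrable (fun ω => ⟪X ω - m, f⟫ * ⟪X ω - m, g⟫) P ∧
    ⟪C f, g⟫ = ∫ ω, ⟪X ω - m, f⟫ * ⟪X ω - m, g⟫ ∂P

/-- The eigenpairs of `C = ∑ i, lam i • ζ i ⊗ ζ i`, with the eigenvalues nonincreasing and repeated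
according to multiplicity, and the eigenvectors orthonormal. Indices start at `0`: `lam i`, `ζ i`
are the `(i + 1)`-st eigenvalue and eigenvector. -/
structure IsEigenSystem (C : H →L[ℝ] H) (lam : ℕ → ℝ) (ζ : ℕ → H) : Prop where
  orthonormal : Orthonormal ℝ ζ
  antitone : Antitone lam
  nonneg : ∀ i, 0 ≤ lam i
  hasSum : ∀ f : H, HasSum (fun i => (lam i * ⟪ζ i, f⟫) • ζ i) (C f)

/-- The `k`-th eigenvalue is strictly larger than the `(k + 1)`-st (no condition for `k = 0`). -/
def SpectralGap (lam : ℕ → ℝ) (k : ℕ) : Prop :=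
  k = 0 ∨ lam k < lam (k - 1)

/-- The square root `C^{1/2} Y = ∑ i, lam i ^ (1/2) ⟨ζ i, Y⟩ ζ i`. -/
def sqrtOp (lam : ℕ → ℝ) (ζ : ℕ → H) (Y : H) : H :=
  ∑' i, (√(lam i) * ⟪ζ i, Y⟫) • ζ i

/-- `W(k)`: orthogonal projection onto the orthogonal complement of the span of the first `k`
eigenvectors. -/
def projW [CompleteSpace H] (ζ : ℕ → H) (k : ℕ) : H →L[ℝ] H :=
  (Submodule.span ℝ (ζ '' Iio k))ᗮ.starProjection

/-- `Z` is a regularized standardization of `X` with respect to `C`: it minimizes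
`‖C^{1/2} Z - X‖² + α ‖W(k) Z‖²`, where `C` has a gap after its `k`-th eigenvalue. -/
def IsRegStd [CompleteSpace H] (α : ℝ) (k : ℕ) (C : H →L[ℝ] H) (X Z : H) : Prop :=
  ∃ (lam : ℕ → ℝ) (ζ : ℕ → H), IsEigenSystem C lam ζ ∧ SpectralGap lam k ∧
    ∀ Y : H, ‖sqrtOp lam ζ Z - X‖ ^ 2 + α * ‖projW ζ k Z‖ ^ 2
      ≤ ‖sqrtOp lam ζ Y - X‖ ^ 2 + α * ‖projW ζ k Y‖ ^ 2

open Classical in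
/-- The regularized standardization of `X` with respect to `C` (the value is `0` where it is not
defined, that is, where `C` has no gap after its `k`-th eigenvalue). -/
def regStd [CompleteSpace H] (α : ℝ) (k : ℕ) (C : H →L[ℝ] H) (X : H) : H :=
  if h : ∃ Z, IsRegStd α k C X Z then h.choose else 0

/-- The squared regularized Mahalanobis distance `M²_{α,k}(X, Y; C)`. -/
def rdmdSq [CompleteSpace H] (α : ℝ) (k : ℕ) (X Y : H) (C : H →L[ℝ] H) : ℝ :=
  ‖regStd α k C X - regStd α k C Y‖ ^ 2

/-- `T n` is a strongly consistent sequence of estimators of `θ`: `T n → θ` almost surely. -/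
def StronglyConsistent {Ω E : Type*} [MeasurableSpace Ω] [TopologicalSpace E] (P : Measure Ω)
    (T : ℕ → Ω → E) (θ : E) : Prop :=
  ∀ᵐ ω ∂P, Tendsto (fun n => T n ω) atTop (𝓝 θ)

end Hilbert

/-- The `χ²(k)` distribution: the law of the sum of the squares of `k` independent standard normal
variables (the point mass at `0` for `k = 0`). -/
def chiSq (k : ℕ) : Measure ℝ :=
  (Measure.pi (fun _ : Fin k => gaussianReal 0 1)).map (fun z => ∑ i, z i ^ 2)

end BayesRDMD

end

/-! Setting the derivative of the penalized functional to zero gives `(C + α W(k)) z = C^{1/2} x`.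
The gap makes `C + α W(k)` coercive, so with `R` its inverse the distance is `⟪C R(x - y), R(x -
y)⟫` (`rdmdSq_eq`), which involves neither a square root nor, by `projW_unique`, a choice of
eigenvectors.

Convergence: Weyl's inequality keeps the gap open under small perturbations, a Davis–Kahan estimate
makes `W(k)` norm continuous in the operator, and inversion is continuous at units. The distance is
therefore jointly continuous in the operator and in `x - y` (`continuousOn_rdmdSq`). Strong
consistency then gives almost sure convergence, hence convergence in distribution. The estimators
are only positive and compact, so their eigenpairs come from the spectral theorem
`exists_isEigenSystem`.

Law: along the eigenvectors the distance is the sum of `lam i / (lam i + α 1_{i ≥ k})² ⟪ζ i, X⟫²`,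
and the `⟪ζ i, X⟫` are independent `N(0, lam i)`. The first `k` terms are thus `χ²(1)`, the others
`lam i² / (lam i + α)²` times `χ²(1)`. Equality of the joint laws of head sum and tail sequence
yields both the law and the convergence of the limiting series. -/

namespace BayesRDMD

/-! ### Eigenvalue and spectral projection perturbation. -/

section EigenSystem

variable {H : Type*} [NormedAddCommGroup H] [InnerProductSpace ℝ H]

namespace IsEigenSystem

variable {C C' : H →L[ℝ] H} {lam lam' : ℕ → ℝ} {ζ ζ' : ℕ → H}

lemma apply_eigenvector (hE : IsEigenSystem C lam ζ) (j : ℕ) : C (ζ j) = lam j • ζ j := by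
  refine (hE.hasSum (ζ j)).unique ?_
  convert hasSum_single j ?_ using 1
  · simp [hE.orthonormal.1 j]
  · intro i hi
    simp [hE.orthonormal.2 hi]

lemma hasSum_inner (hE : IsEigenSystem C lam ζ) (f g : H) :
    HasSum (fun i => lam i * ⟪ζ i, f⟫ * ⟪ζ i, g⟫) ⟪C f, g⟫ := by
  have h := (hE.hasSum f).mapL (innerSL ℝ g)
  simp only [map_smul, innerSL_apply_apply, smul_eq_mul] at h
  simpa only [real_inner_comm] using h

lemma inner_comm (hE : IsEigenSystem C lam ζ) (f g : H) : ⟪C f, g⟫ = ⟪f, C g⟫ := by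
  refine (hE.hasSum_inner f g).unique ?_
  rw [real_inner_comm]
  convert hE.hasSum_inner g f using 2
  ring

lemma inner_eigenvector_apply (hE : IsEigenSystem C lam ζ) (i : ℕ) (f : H) :
    ⟪ζ i, C f⟫ = lam i * ⟪ζ i, f⟫ := by
  rw [← hE.inner_comm, hE.apply_eigenvector, real_inner_smul_left]

/-- Terms below `k` vanish, later eigenvalues are at most `lam k`, and Bessel's inequality finishes,
so `ζ` need not be complete. -/
lemma inner_apply_self_le (hE : IsEigenSystem C lam ζ) {k : ℕ} {f : H}
    (hf : ∀ i < k, ⟪ζ i, f⟫ = 0) : ⟪C f, f⟫ ≤ lam k * ‖f‖ ^ 2 := by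
  have hs := hE.orthonormal.inner_products_summable (x := f)
  calc ⟪C f, f⟫ ≤ ∑' i, lam k * ‖⟪ζ i, f⟫‖ ^ 2 := by
        refine hasSum_le (fun i => ?_) (hE.hasSum_inner f f) (hs.mul_left _).hasSum
        rcases lt_or_ge i k with hi | hi
        · simp [hf i hi]
        · rw [Real.norm_eq_abs, sq_abs, mul_assoc, ← sq]
          exact mul_le_mul_of_nonneg_right (hE.antitone hi) (sq_nonneg _)
    _ = lam k * ∑' i, ‖⟪ζ i, f⟫‖ ^ 2 := tsum_mul_left
    _ ≤ lam k * ‖f‖ ^ 2 :=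
        mul_le_mul_of_nonneg_left (hE.orthonormal.tsum_inner_products_le f) (hE.nonneg k)

/-- **Weyl's inequality** for eigenvalues. -/
lemma eigenvalue_le_add_norm_sub (hE : IsEigenSystem C lam ζ) (hE' : IsEigenSystem C' lam' ζ')
    (k : ℕ) : lam k ≤ lam' k + ‖C' - C‖ := by
  let V : (Fin (k + 1) → ℝ) →ₗ[ℝ] H := Fintype.linearCombination ℝ (fun i => ζ i)
  let T : (Fin (k + 1) → ℝ) →ₗ[ℝ] (Fin k → ℝ) :=
    LinearMap.pi fun j => (innerₛₗ ℝ (ζ' j)) ∘ₗ V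
  -- Dimension count: some nonzero combination of `ζ 0, …, ζ k` is orthogonal to the `k` vectors `ζ'
  -- 0, …, ζ' (k - 1)`. On it the quadratic form of `C` is at least `lam k`, that of `C'` at most
  -- `lam' k`.
  have hT : LinearMap.ker T ≠ ⊥ := LinearMap.ker_ne_bot_of_finrank_lt (by simp)
  obtain ⟨c, hc, hc0⟩ := (Submodule.ne_bot_iff _).1 hT
  have ho : Orthonormal ℝ (fun i : Fin (k + 1) => ζ i) :=
    hE.orthonormal.comp _ Fin.val_injective
  have hV : V c = ∑ i, c i • ζ i := by simp [V, Fintype.linearCombination_apply]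
  have hnorm : ‖V c‖ ^ 2 = ∑ i, c i ^ 2 := by
    rw [← real_inner_self_eq_norm_sq, hV, ho.inner_sum]
    simp [sq]
  have hpos : 0 < ‖V c‖ ^ 2 := by
    rw [hnorm]
    obtain ⟨i, hi⟩ := Function.ne_iff.1 hc0
    exact Finset.sum_pos' (fun i _ => sq_nonneg _) ⟨i, Finset.mem_univ _, by
      have : c i ≠ 0 := hi
      positivity⟩
  have h1 : lam k * ‖V c‖ ^ 2 ≤ ⟪C (V c), V c⟫ := by
    have : C (V c) = ∑ i : Fin (k + 1), (lam i * c i) • ζ i := by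
      rw [hV, map_sum]
      refine Finset.sum_congr rfl fun i _ => ?_
      rw [map_smul, hE.apply_eigenvector, smul_smul, mul_comm]
    rw [this, hV, ho.inner_sum, ← hV, hnorm, Finset.mul_sum]
    refine Finset.sum_le_sum fun i _ => ?_
    have := mul_le_mul_of_nonneg_right (hE.antitone (Nat.lt_succ_iff.1 i.2)) (sq_nonneg (c i))
    simpa [sq, mul_assoc] using this
  have h2 : ⟪C' (V c), V c⟫ ≤ lam' k * ‖V c‖ ^ 2 := by
    refine hE'.inner_apply_self_le fun i hi => ?_
    have := congrFun (LinearMap.mem_ker.1 hc) ⟨i, hi⟩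
    simpa [T] using this
  have h3 : ⟪(C - C') (V c), V c⟫ ≤ ‖C' - C‖ * ‖V c‖ ^ 2 := by
    calc ⟪(C - C') (V c), V c⟫ ≤ ‖(C - C') (V c)‖ * ‖V c‖ := real_inner_le_norm _ _
      _ ≤ (‖C - C'‖ * ‖V c‖) * ‖V c‖ := by
        gcongr
        exact (C - C').le_opNorm _
      _ = ‖C' - C‖ * ‖V c‖ ^ 2 := by rw [norm_sub_rev]; ring
  rw [sub_apply, inner_sub_left] at h3
  refine le_of_mul_le_mul_right ?_ hpos
  linarith

end IsEigenSystem

section Projection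

variable [CompleteSpace H]

lemma projW_apply {ζ : ℕ → H} (hζ : Orthonormal ℝ ζ) (k : ℕ) (f : H) :
    projW ζ k f = f - ∑ i ∈ Finset.range k, ⟪ζ i, f⟫ • ζ i := by
  have : FiniteDimensional ℝ (Submodule.span ℝ (ζ '' Iio k)) :=
    FiniteDimensional.span_of_finite ℝ ((finite_Iio k).image ζ)
  rw [projW, Submodule.starProjection_orthogonal_val]
  congr 1
  refine Submodule.eq_starProjection_of_mem_orthogonal ?_ ?_
  · refine Submodule.sum_mem _ fun i hi => Submodule.smul_mem _ _ ?_
    exact Submodule.subset_span ⟨i, Finset.mem_range.1 hi, rfl⟩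
  · rw [Submodule.mem_orthogonal]
    intro u hu
    induction hu using Submodule.span_induction with
    | mem u hu =>
      obtain ⟨j, hj, rfl⟩ := hu
      rw [inner_sub_right, hζ.inner_right_sum _ (Finset.mem_range.2 hj), sub_self]
    | zero => simp
    | add u v _ _ hu hv => rw [inner_add_left, hu, hv, add_zero]
    | smul c u _ hu => rw [real_inner_smul_left, hu, mul_zero]

lemma inner_projW_comm (ζ : ℕ → H) (k : ℕ) (f g : H) :
    ⟪projW ζ k f, g⟫ = ⟪f, projW ζ k g⟫ :=
  Submodule.inner_starProjection_left_eq_right _ _ _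

lemma projW_projW (ζ : ℕ → H) (k : ℕ) (f : H) : projW ζ k (projW ζ k f) = projW ζ k f :=
  Submodule.starProjection_eq_self_iff.2 (Submodule.starProjection_apply_mem _ _)

lemma inner_projW_self (ζ : ℕ → H) (k : ℕ) (f : H) : ⟪projW ζ k f, f⟫ = ‖projW ζ k f‖ ^ 2 := by
  rw [← real_inner_self_eq_norm_sq, ← inner_projW_comm, projW_projW]

lemma inner_eigenvector_projW {ζ : ℕ → H} (hζ : Orthonormal ℝ ζ) (k i : ℕ) (f : H) :
    ⟪ζ i, projW ζ k f⟫ = if i < k then 0 else ⟪ζ i, f⟫ := by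
  rw [projW_apply hζ, inner_sub_right]
  split_ifs with hi
  · rw [hζ.inner_right_sum _ (Finset.mem_range.2 hi), sub_self]
  · rw [inner_sum, Finset.sum_eq_zero, sub_zero]
    intro j hj
    rw [real_inner_smul_right, hζ.2, mul_zero]
    rintro rfl
    exact hi (Finset.mem_range.1 hj)

/-- With `P = 1 - W` and `P' = 1 - W'`, one has `W - W' = P' W - W' P`. Expanding `P` and `P'` in
their eigenvectors leaves only the cross terms `W' ζ i` and `W ζ' i`. -/
lemma norm_projW_sub_le {ζ ζ' : ℕ → H} (hζ : Orthonormal ℝ ζ) (hζ' : Orthonormal ℝ ζ') (k : ℕ) :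
    ‖projW ζ k - projW ζ' k‖
      ≤ ∑ i ∈ Finset.range k, (‖projW ζ' k (ζ i)‖ + ‖projW ζ k (ζ' i)‖) := by
  refine ContinuousLinearMap.opNorm_le_bound _
    (Finset.sum_nonneg fun i _ => by positivity) fun f => ?_
  have h1 : (projW ζ k - projW ζ' k) f = ∑ i ∈ Finset.range k, ⟪projW ζ k (ζ' i), f⟫ • ζ' i
      - ∑ i ∈ Finset.range k, ⟪ζ i, f⟫ • projW ζ' k (ζ i) := by
    have e1 : ∑ i ∈ Finset.range k, ⟪projW ζ k (ζ' i), f⟫ • ζ' i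
        = projW ζ k f - projW ζ' k (projW ζ k f) := by
      rw [projW_apply hζ' k (projW ζ k f), sub_sub_cancel]
      simp_rw [inner_projW_comm]
    have e2 : ∑ i ∈ Finset.range k, ⟪ζ i, f⟫ • projW ζ' k (ζ i)
        = projW ζ' k f - projW ζ' k (projW ζ k f) := by
      rw [projW_apply hζ k f, map_sub, sub_sub_cancel, map_sum]
      simp_rw [map_smul]
    rw [e1, e2, sub_apply]
    abel
  rw [h1, Finset.sum_add_distrib, add_mul, add_comm]
  refine (norm_sub_le _ _).trans (add_le_add ?_ ?_)
  · refine (norm_sum_le _ _).trans ?_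
    rw [Finset.sum_mul]
    refine Finset.sum_le_sum fun i _ => ?_
    rw [norm_smul, hζ'.1 i, mul_one]
    exact norm_inner_le_norm _ _
  · refine (norm_sum_le _ _).trans ?_
    rw [Finset.sum_mul]
    refine Finset.sum_le_sum fun i _ => ?_
    rw [norm_smul, mul_comm]
    gcongr
    simpa [hζ.1 i] using norm_inner_le_norm (𝕜 := ℝ) (ζ i) f

end Projection

namespace IsEigenSystem

variable [CompleteSpace H] {C C' : H →L[ℝ] H} {lam lam' : ℕ → ℝ} {ζ ζ' : ℕ → H}

lemma apply_projW (hE : IsEigenSystem C lam ζ) (k : ℕ) (f : H) :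
    C (projW ζ k f) = projW ζ k (C f) := by
  simp only [projW_apply hE.orthonormal, map_sub, map_sum, map_smul, hE.apply_eigenvector,
    hE.inner_eigenvector_apply, smul_smul, mul_comm]

/-- A one-sided **Davis–Kahan** estimate for the leading eigenvectors. -/
lemma gap_mul_norm_projW_le (hE : IsEigenSystem C lam ζ) (hE' : IsEigenSystem C' lam' ζ')
    (k i : ℕ) : (lam i - lam' k) * ‖projW ζ' k (ζ i)‖ ≤ ‖C' - C‖ := by
  set u := projW ζ' k (ζ i) with hu
  rcases eq_or_ne u 0 with h0 | h0
  · simp [h0]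
  have hpos : 0 < ‖u‖ := norm_pos_iff.2 h0
  have h1 : ⟪C' u, u⟫ ≤ lam' k * ‖u‖ ^ 2 :=
    hE'.inner_apply_self_le fun j hj => by
      rw [hu, inner_eigenvector_projW hE'.orthonormal, if_pos hj]
  -- `C'` commutes with its own `W'`. Hence `⟪u, (C - C') (ζ i)⟫` equals `lam i ‖u‖² - ⟪C' u, u⟫`,
  -- at least `(lam i - lam' k) ‖u‖²`; one factor `‖u‖` is cancelled at the end.
  have h2 : ⟪u, C' (ζ i)⟫ = ⟪C' u, u⟫ := by
    rw [← hE'.inner_comm, hu, hE'.apply_projW, ← inner_projW_comm, projW_projW]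
  have h3 : ⟪u, C (ζ i)⟫ = lam i * ‖u‖ ^ 2 := by
    rw [hE.apply_eigenvector, real_inner_smul_right, hu, inner_projW_self]
  have h4 : ⟪u, (C - C') (ζ i)⟫ ≤ ‖u‖ * ‖C' - C‖ := by
    refine (real_inner_le_norm _ _).trans ?_
    gcongr
    rw [norm_sub_rev]
    simpa [hE.orthonormal.1 i] using (C - C').le_opNorm (ζ i)
  rw [sub_apply, inner_sub_right, h2, h3] at h4
  refine le_of_mul_le_mul_left ?_ hpos
  nlinarith

/-- Stability of the spectral projections under perturbation of the operator. -/
lemma gap_mul_norm_projW_sub_le (hE : IsEigenSystem C lam ζ) (hE' : IsEigenSystem C' lam' ζ')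
    {k : ℕ} {δ : ℝ} (hδ : ∀ i < k, δ ≤ lam i - lam k) :
    (δ - ‖C' - C‖) * ‖projW ζ k - projW ζ' k‖ ≤ 2 * k * ‖C' - C‖ := by
  rcases le_or_gt (δ - ‖C' - C‖) 0 with h | h
  · exact (mul_nonpos_of_nonpos_of_nonneg h (norm_nonneg _)).trans (by positivity)
  refine (mul_le_mul_of_nonneg_left
    (norm_projW_sub_le hE.orthonormal hE'.orthonormal k) h.le).trans ?_
  rw [Finset.mul_sum]
  have : ∀ i ∈ Finset.range k, (δ - ‖C' - C‖) * (‖projW ζ' k (ζ i)‖ + ‖projW ζ k (ζ' i)‖)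
      ≤ 2 * ‖C' - C‖ := by
    intro i hi
    -- By Weyl, both mixed gaps `lam i - lam' k` and `lam' i - lam k` are at least `δ - ‖C' - C‖`;
    -- each of the two cross terms then costs one `‖C' - C‖`.
    have hi := hδ i (Finset.mem_range.1 hi)
    have w1 := hE'.eigenvalue_le_add_norm_sub hE k
    have w2 := hE.eigenvalue_le_add_norm_sub hE' i
    have d1 := hE.gap_mul_norm_projW_le hE' k i
    have d2 := hE'.gap_mul_norm_projW_le hE k i
    rw [norm_sub_rev] at w1 d2
    have n1 : (δ - ‖C' - C‖) * ‖projW ζ' k (ζ i)‖ ≤ (lam i - lam' k) * ‖projW ζ' k (ζ i)‖ := by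
      exact mul_le_mul_of_nonneg_right (by linarith) (norm_nonneg _)
    have n2 : (δ - ‖C' - C‖) * ‖projW ζ k (ζ' i)‖ ≤ (lam' i - lam k) * ‖projW ζ k (ζ' i)‖ := by
      exact mul_le_mul_of_nonneg_right (by linarith) (norm_nonneg _)
    linarith
  refine (Finset.sum_le_sum this).trans (le_of_eq ?_)
  simp
  ring

end IsEigenSystem

/-- The smallest margin occurs at `i = k - 1`; for `k = 0` there is no constraint and `1` is
arbitrary. -/
lemma SpectralGap.exists_pos {lam : ℕ → ℝ} (hl : Antitone lam) {k : ℕ} (hk : SpectralGap lam k) :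
    ∃ δ > 0, ∀ i < k, δ ≤ lam i - lam k := by
  rcases hk with rfl | hk
  · exact ⟨1, one_pos, by simp⟩
  · refine ⟨lam (k - 1) - lam k, sub_pos.2 hk, fun i hi => ?_⟩
    have := hl (Nat.le_sub_one_of_lt hi)
    linarith

/-- The perturbation bound with `C' = C`: across a gap the projection is a function of the operator
alone. -/
lemma IsEigenSystem.projW_unique [CompleteSpace H] {C : H →L[ℝ] H} {lam lam' : ℕ → ℝ}
    {ζ ζ' : ℕ → H} (hE : IsEigenSystem C lam ζ) (hE' : IsEigenSystem C lam' ζ') {k : ℕ}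
    (hk : SpectralGap lam k) : projW ζ k = projW ζ' k := by
  obtain ⟨δ, hδ, h⟩ := hk.exists_pos hE.antitone
  have := hE.gap_mul_norm_projW_sub_le hE' h
  simp only [sub_self, norm_zero, sub_zero, mul_zero] at this
  exact sub_eq_zero.1 (norm_le_zero_iff.1 (nonpos_of_mul_nonpos_right this hδ))

end EigenSystem

/-! ### Normal equations and closed forms of the distance. -/

section Standardization

variable {H : Type*} [NormedAddCommGroup H] [InnerProductSpace ℝ H] [CompleteSpace H]
  {C : H →L[ℝ] H} {lam lam' : ℕ → ℝ} {ζ ζ' : ℕ → H}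

lemma summable_smul_of_summable_sq {ζ : ℕ → H} (hζ : Orthonormal ℝ ζ) {c : ℕ → ℝ}
    (hc : Summable fun i => c i ^ 2) : Summable fun i => c i • ζ i := by
  have := (hζ.orthogonalFamily.summable_iff_norm_sq_summable c).2 (by simpa using hc)
  simpa using this

namespace IsEigenSystem

/-- `sqrtOp` is a `tsum`, hence `0` by default without summability; `√(lam i) ≤ √(lam 0)` and
Bessel's inequality exclude that case. -/
lemma hasSum_sqrtOp (hE : IsEigenSystem C lam ζ) (f : H) :
    HasSum (fun i => (√(lam i) * ⟪ζ i, f⟫) • ζ i) (sqrtOp lam ζ f) := by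
  refine (summable_smul_of_summable_sq hE.orthonormal ?_).hasSum
  refine Summable.of_nonneg_of_le (fun i => sq_nonneg _) (fun i => ?_)
    ((hE.orthonormal.inner_products_summable (x := f)).mul_left (lam 0))
  rw [mul_pow, Real.sq_sqrt (hE.nonneg i), Real.norm_eq_abs, sq_abs]
  exact mul_le_mul_of_nonneg_right (hE.antitone (Nat.zero_le i)) (sq_nonneg _)

lemma sqrtOp_add (hE : IsEigenSystem C lam ζ) (f g : H) :
    sqrtOp lam ζ (f + g) = sqrtOp lam ζ f + sqrtOp lam ζ g := by
  refine (hE.hasSum_sqrtOp _).unique ?_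
  convert (hE.hasSum_sqrtOp f).add (hE.hasSum_sqrtOp g) using 2
  rw [inner_add_right, mul_add, add_smul]

lemma sqrtOp_smul (hE : IsEigenSystem C lam ζ) (c : ℝ) (f : H) :
    sqrtOp lam ζ (c • f) = c • sqrtOp lam ζ f := by
  refine (hE.hasSum_sqrtOp _).unique ?_
  convert (hE.hasSum_sqrtOp f).const_smul c using 2
  rw [real_inner_smul_right, smul_smul]
  congr 1
  ring

lemma sqrtOp_sub (hE : IsEigenSystem C lam ζ) (f g : H) :
    sqrtOp lam ζ (f - g) = sqrtOp lam ζ f - sqrtOp lam ζ g := by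
  rw [sub_eq_add_neg, hE.sqrtOp_add, ← neg_one_smul ℝ g, hE.sqrtOp_smul, neg_one_smul,
    ← sub_eq_add_neg]

lemma hasSum_inner_sqrtOp (hE : IsEigenSystem C lam ζ) (f g : H) :
    HasSum (fun i => √(lam i) * ⟪ζ i, f⟫ * ⟪ζ i, g⟫) ⟪sqrtOp lam ζ f, g⟫ := by
  have h := (hE.hasSum_sqrtOp f).mapL (innerSL ℝ g)
  simp only [map_smul, innerSL_apply_apply, smul_eq_mul] at h
  simpa only [real_inner_comm] using h

lemma inner_sqrtOp_comm (hE : IsEigenSystem C lam ζ) (f g : H) :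
    ⟪sqrtOp lam ζ f, g⟫ = ⟪f, sqrtOp lam ζ g⟫ := by
  refine (hE.hasSum_inner_sqrtOp f g).unique ?_
  rw [real_inner_comm]
  convert hE.hasSum_inner_sqrtOp g f using 2
  ring

lemma inner_sqrtOp_self_nonneg (hE : IsEigenSystem C lam ζ) (f : H) :
    0 ≤ ⟪sqrtOp lam ζ f, f⟫ :=
  (hE.hasSum_inner_sqrtOp f f).nonneg fun i => by
    rw [mul_assoc]; exact mul_nonneg (Real.sqrt_nonneg _) (mul_self_nonneg _)

lemma sqrtOp_eigenvector (hE : IsEigenSystem C lam ζ) (i : ℕ) :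
    sqrtOp lam ζ (ζ i) = √(lam i) • ζ i := by
  refine (hE.hasSum_sqrtOp (ζ i)).unique ?_
  convert hasSum_single i ?_ using 1
  · simp [hE.orthonormal.1 i]
  · intro j hj
    simp [hE.orthonormal.2 hj]

lemma inner_eigenvector_sqrtOp (hE : IsEigenSystem C lam ζ) (i : ℕ) (f : H) :
    ⟪ζ i, sqrtOp lam ζ f⟫ = √(lam i) * ⟪ζ i, f⟫ := by
  rw [← hE.inner_sqrtOp_comm, hE.sqrtOp_eigenvector, real_inner_smul_left]

lemma sqrtOp_sqrtOp (hE : IsEigenSystem C lam ζ) (f : H) :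
    sqrtOp lam ζ (sqrtOp lam ζ f) = C f := by
  refine (hE.hasSum_sqrtOp _).unique ?_
  convert hE.hasSum f using 3
  rw [hE.inner_eigenvector_sqrtOp, ← mul_assoc, Real.mul_self_sqrt (hE.nonneg _)]

lemma inner_apply_self_eq (hE : IsEigenSystem C lam ζ) (f : H) :
    ⟪C f, f⟫ = ‖sqrtOp lam ζ f‖ ^ 2 := by
  rw [← hE.sqrtOp_sqrtOp, hE.inner_sqrtOp_comm, real_inner_self_eq_norm_sq]

lemma sqrtOp_eq_zero (hE : IsEigenSystem C lam ζ) {f : H} (hf : C f = 0) :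
    sqrtOp lam ζ f = 0 := by
  have := hE.inner_apply_self_eq f
  rw [hf, inner_zero_left] at this
  exact norm_eq_zero.1 (pow_eq_zero_iff two_ne_zero |>.1 this.symm)

/-- Let `S`, `S'` be the two roots. On `ζ' j` with `lam' j > 0`, factor `C - lam' j = (S + √(lam'
j)) (S - √(lam' j))`, whose first factor is injective because `S ≥ 0`; if `lam' j = 0`, `S` kills
the kernel of `C`. As `ζ'` need not be complete, `v = S f - S' f` is only orthogonal to every `ζ'
j`. This still gives `C v = 0`, so both roots kill `v` and `⟪v, v⟫ = 0`. -/
lemma sqrtOp_unique (hE : IsEigenSystem C lam ζ) (hE' : IsEigenSystem C lam' ζ') :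
    sqrtOp lam ζ = sqrtOp lam' ζ' := by
  have hev : ∀ j, sqrtOp lam ζ (ζ' j) = √(lam' j) • ζ' j := by
    intro j
    set u := sqrtOp lam ζ (ζ' j) - √(lam' j) • ζ' j with hu
    rcases (hE'.nonneg j).eq_or_lt with h0 | h0
    · have : C (ζ' j) = 0 := by rw [hE'.apply_eigenvector, ← h0, zero_smul]
      rw [hE.sqrtOp_eq_zero this, ← h0, Real.sqrt_zero, zero_smul]
    · have h1 : sqrtOp lam ζ u + √(lam' j) • u = 0 := by
        rw [hu, hE.sqrtOp_sub, hE.sqrtOp_smul, hE.sqrtOp_sqrtOp, hE'.apply_eigenvector, smul_sub,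
          smul_smul, Real.mul_self_sqrt h0.le]
        abel
      have h2 := congrArg (fun w => ⟪w, u⟫) h1
      simp only [inner_add_left, real_inner_smul_left, inner_zero_left] at h2
      have h3 := hE.inner_sqrtOp_self_nonneg u
      have h4 : √(lam' j) * ⟪u, u⟫ ≤ 0 := by linarith
      have h5 : ⟪u, u⟫ ≤ 0 := nonpos_of_mul_nonpos_right h4 (Real.sqrt_pos.2 h0)
      exact sub_eq_zero.1 (inner_self_eq_zero.1 (h5.antisymm real_inner_self_nonneg))
  have horth : ∀ f j, ⟪sqrtOp lam ζ f - sqrtOp lam' ζ' f, ζ' j⟫ = 0 := by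
    intro f j
    rw [inner_sub_left, hE.inner_sqrtOp_comm, hE'.inner_sqrtOp_comm, hev, hE'.sqrtOp_eigenvector,
      sub_self]
  ext f
  set v := sqrtOp lam ζ f - sqrtOp lam' ζ' f with hv
  have hCv : C v = 0 := by
    refine (hE'.hasSum v).unique ?_
    convert hasSum_zero with j
    rw [real_inner_comm, horth, mul_zero, zero_smul]
  have : ⟪v, v⟫ = 0 := by
    nth_rewrite 2 [hv]
    rw [inner_sub_right, ← hE.inner_sqrtOp_comm, ← hE'.inner_sqrtOp_comm, hE.sqrtOp_eq_zero hCv,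
      hE'.sqrtOp_eq_zero hCv, sub_self]
  exact sub_eq_zero.1 (inner_self_eq_zero.1 this)

lemma sqrtOp_projW (hE : IsEigenSystem C lam ζ) (k : ℕ) (f : H) :
    sqrtOp lam ζ (projW ζ k f) = projW ζ k (sqrtOp lam ζ f) := by
  refine (hE.hasSum_sqrtOp _).unique ?_
  convert (hE.hasSum_sqrtOp f).mapL (projW ζ k) using 2 with i
  have : projW ζ k (ζ i) = if i < k then 0 else ζ i := by
    rw [projW_apply hE.orthonormal]
    have e : ∀ j ∈ Finset.range k, ⟪ζ j, ζ i⟫ • ζ j = if i = j then ζ i else 0 := by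
      intro j _
      split_ifs with h
      · subst h; simp [hE.orthonormal.1 i]
      · rw [hE.orthonormal.2 (Ne.symm h), zero_smul]
    rw [Finset.sum_congr rfl e, Finset.sum_ite_eq]
    simp only [Finset.mem_range]
    split_ifs <;> simp
  rw [inner_eigenvector_projW hE.orthonormal, map_smul, this]
  split_ifs <;> simp

end IsEigenSystem

/-- The operator `C + α W(k)` of the normal equations of the regularized standardization. -/
noncomputable def normalOp (α : ℝ) (k : ℕ) (C : H →L[ℝ] H) (ζ : ℕ → H) : H →L[ℝ] H :=
  C + α • projW ζ k

lemma normalOp_apply (α : ℝ) (k : ℕ) (C : H →L[ℝ] H) (ζ : ℕ → H) (f : H) :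
    normalOp α k C ζ f = C f + α • projW ζ k f := rfl

namespace IsEigenSystem

variable {α : ℝ} {k : ℕ}

lemma inner_normalOp_self (hE : IsEigenSystem C lam ζ) (α : ℝ) (k : ℕ) (f : H) :
    ⟪normalOp α k C ζ f, f⟫ = ‖sqrtOp lam ζ f‖ ^ 2 + α * ‖projW ζ k f‖ ^ 2 := by
  rw [normalOp_apply, inner_add_left, hE.inner_apply_self_eq, real_inner_smul_left,
    inner_projW_self]

lemma inner_normalOp_comm (hE : IsEigenSystem C lam ζ) (α : ℝ) (k : ℕ) (f g : H) :
    ⟪normalOp α k C ζ f, g⟫ = ⟪f, normalOp α k C ζ g⟫ := by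
  rw [normalOp_apply, normalOp_apply, inner_add_left, inner_add_right, hE.inner_comm,
    real_inner_smul_left, real_inner_smul_right, inner_projW_comm]

lemma normalOp_eigenvector (hE : IsEigenSystem C lam ζ) (α : ℝ) (k i : ℕ) (f : H) :
    ⟪ζ i, normalOp α k C ζ f⟫ = (lam i + if i < k then 0 else α) * ⟪ζ i, f⟫ := by
  rw [normalOp_apply, inner_add_right, hE.inner_eigenvector_apply, real_inner_smul_right,
    inner_eigenvector_projW hE.orthonormal]
  split_ifs <;> ring

/-- On the leading eigenvectors, which are not penalized, `lam i ≥ δ`; on their orthogonal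
complement the penalty contributes `α`. -/
lemma normalOp_coercive (hE : IsEigenSystem C lam ζ) (hα : 0 < α) (hk : SpectralGap lam k) :
    ∃ c > 0, ∀ f, c * ‖f‖ ^ 2 ≤ ⟪normalOp α k C ζ f, f⟫ := by
  obtain ⟨δ, hδ, h⟩ := hk.exists_pos hE.antitone
  refine ⟨min δ α, lt_min hδ hα, fun f => ?_⟩
  have h1 : δ * ∑ i ∈ Finset.range k, ⟪ζ i, f⟫ ^ 2 ≤ ⟪C f, f⟫ := by
    rw [Finset.mul_sum]
    refine le_trans (Finset.sum_le_sum fun i hi => ?_)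
      (sum_le_hasSum (Finset.range k) (fun i _ => ?_) (hE.hasSum_inner f f))
    · have := h i (Finset.mem_range.1 hi)
      have h0 := hE.nonneg k
      rw [mul_assoc, ← sq]
      exact mul_le_mul_of_nonneg_right (by linarith) (sq_nonneg _)
    · rw [mul_assoc]; exact mul_nonneg (hE.nonneg i) (mul_self_nonneg _)
  have h2 : ‖f‖ ^ 2 = ∑ i ∈ Finset.range k, ⟪ζ i, f⟫ ^ 2 + ‖projW ζ k f‖ ^ 2 := by
    rw [← inner_projW_self, projW_apply hE.orthonormal, inner_sub_left, sum_inner,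
      real_inner_self_eq_norm_sq]
    simp_rw [real_inner_smul_left, ← sq]
    ring
  have h3 : 0 ≤ ∑ i ∈ Finset.range k, ⟪ζ i, f⟫ ^ 2 := Finset.sum_nonneg fun i _ => sq_nonneg _
  rw [hE.inner_normalOp_self, ← hE.inner_apply_self_eq, h2, mul_add]
  refine add_le_add (le_trans ?_ h1) ?_
  · exact mul_le_mul_of_nonneg_right (min_le_left _ _) h3
  · exact mul_le_mul_of_nonneg_right (min_le_right _ _) (sq_nonneg _)

lemma isUnit_normalOp (hE : IsEigenSystem C lam ζ) (hα : 0 < α) (hk : SpectralGap lam k) :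
    IsUnit (normalOp α k C ζ) := by
  obtain ⟨c, hc, h⟩ := hE.normalOp_coercive hα hk
  refine ContinuousLinearMap.isUnit_of_forall_le_norm_inner_map _ (c := ⟨c, hc.le⟩) hc fun f => ?_
  rw [mul_comm]
  exact (h f).trans (le_abs_self _)

lemma normalOp_inverse_apply (hE : IsEigenSystem C lam ζ) (hα : 0 < α) (hk : SpectralGap lam k)
    (f : H) : normalOp α k C ζ (Ring.inverse (normalOp α k C ζ) f) = f := by
  have := Ring.mul_inverse_cancel _ (hE.isUnit_normalOp hα hk)
  simpa using congrArg (fun T : H →L[ℝ] H => T f) this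

lemma inverse_normalOp_apply (hE : IsEigenSystem C lam ζ) (hα : 0 < α) (hk : SpectralGap lam k)
    (f : H) : Ring.inverse (normalOp α k C ζ) (normalOp α k C ζ f) = f := by
  have := Ring.inverse_mul_cancel _ (hE.isUnit_normalOp hα hk)
  simpa using congrArg (fun T : H →L[ℝ] H => T f) this

/-- Completing the square around a solution `z` of the normal equations: the last bracket does not
depend on `w`. -/
lemma objective_eq (hE : IsEigenSystem C lam ζ) (α : ℝ) (k : ℕ) (x z w : H)
    (hz : normalOp α k C ζ z = sqrtOp lam ζ x) :
    ‖sqrtOp lam ζ w - x‖ ^ 2 + α * ‖projW ζ k w‖ ^ 2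
      = ⟪normalOp α k C ζ (w - z), w - z⟫ + (‖x‖ ^ 2 - ⟪normalOp α k C ζ z, z⟫) := by
  have e1 : ⟪sqrtOp lam ζ w, x⟫ = ⟪normalOp α k C ζ z, w⟫ := by
    rw [hz, hE.inner_sqrtOp_comm, real_inner_comm]
  have e2 := hE.inner_normalOp_self α k w
  have e3 : ⟪normalOp α k C ζ w, z⟫ = ⟪normalOp α k C ζ z, w⟫ := by
    rw [hE.inner_normalOp_comm, real_inner_comm]
  rw [norm_sub_sq_real, map_sub, inner_sub_left, inner_sub_right, inner_sub_right, e1, e2, e3]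
  ring

lemma isRegStd_iff (hE : IsEigenSystem C lam ζ) (hα : 0 < α) (hk : SpectralGap lam k) (x z : H) :
    IsRegStd α k C x z ↔ normalOp α k C ζ z = sqrtOp lam ζ x := by
  constructor
  · rintro ⟨lam', ζ', hE', hk', hmin⟩
    -- `IsRegStd` carries its own eigenpairs; projection and root depend only on `C`, so they may be
    -- exchanged for the given ones.
    have hN : normalOp α k C ζ = normalOp α k C ζ' := by
      rw [normalOp, normalOp, hE.projW_unique hE' hk]
    rw [hN, hE.sqrtOp_unique hE']
    set z₀ := Ring.inverse (normalOp α k C ζ') (sqrtOp lam' ζ' x)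
    have hz₀ : normalOp α k C ζ' z₀ = sqrtOp lam' ζ' x := hE'.normalOp_inverse_apply hα hk' _
    have h := hmin z₀
    rw [hE'.objective_eq α k x z₀ z hz₀, hE'.objective_eq α k x z₀ z₀ hz₀, sub_self, inner_zero_right,
      add_le_add_iff_right] at h
    obtain ⟨c, hc, hco⟩ := hE'.normalOp_coercive hα hk'
    have h0 : ‖z - z₀‖ ^ 2 ≤ 0 := nonpos_of_mul_nonpos_right ((hco _).trans h) hc
    have : z - z₀ = 0 := by
      rw [← norm_eq_zero, ← sq_eq_zero_iff]
      exact le_antisymm h0 (sq_nonneg _)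
    rw [sub_eq_zero.1 this, hz₀]
  · intro hz
    refine ⟨lam, ζ, hE, hk, fun w => ?_⟩
    rw [hE.objective_eq α k x z z hz, hE.objective_eq α k x z w hz, sub_self, inner_zero_right]
    obtain ⟨c, hc, hco⟩ := hE.normalOp_coercive hα hk
    have := (mul_nonneg hc.le (sq_nonneg ‖w - z‖)).trans (hco (w - z))
    linarith

lemma normalOp_regStd (hE : IsEigenSystem C lam ζ) (hα : 0 < α) (hk : SpectralGap lam k) (x : H) :
    normalOp α k C ζ (regStd α k C x) = sqrtOp lam ζ x := by
  have h : ∃ z, IsRegStd α k C x z :=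
    ⟨_, (hE.isRegStd_iff hα hk x _).2 (hE.normalOp_inverse_apply hα hk (sqrtOp lam ζ x))⟩
  rw [regStd, dif_pos h]
  exact (hE.isRegStd_iff hα hk x _).1 h.choose_spec

/-- A closed form of the regularized Mahalanobis distance that avoids the square root. -/
lemma rdmdSq_eq (hE : IsEigenSystem C lam ζ) (hα : 0 < α) (hk : SpectralGap lam k) (x y : H) :
    rdmdSq α k x y C = ⟪C (Ring.inverse (normalOp α k C ζ) (x - y)),
      Ring.inverse (normalOp α k C ζ) (x - y)⟫ := by
  set R := Ring.inverse (normalOp α k C ζ)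
  -- The root `S` commutes with `C + α W(k)`, so the standardized difference is `S (R (x - y))`, and
  -- `‖S u‖² = ⟪C u, u⟫`.
  have hcomm : normalOp α k C ζ (sqrtOp lam ζ (R (x - y))) = sqrtOp lam ζ (x - y) := by
    conv_rhs => rw [← hE.normalOp_inverse_apply hα hk (x - y)]
    rw [normalOp_apply, normalOp_apply, hE.sqrtOp_add, hE.sqrtOp_smul, hE.sqrtOp_projW,
      ← hE.sqrtOp_sqrtOp, ← hE.sqrtOp_sqrtOp]
  have : regStd α k C x - regStd α k C y = sqrtOp lam ζ (R (x - y)) := by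
    rw [← hE.inverse_normalOp_apply hα hk (regStd α k C x - regStd α k C y), map_sub,
      hE.normalOp_regStd hα hk, hE.normalOp_regStd hα hk, ← hE.sqrtOp_sub, ← hcomm,
      hE.inverse_normalOp_apply hα hk]
  rw [rdmdSq, this, hE.inner_apply_self_eq]

/-- The series expansion of the regularized Mahalanobis distance. -/
lemma hasSum_rdmdSq (hE : IsEigenSystem C lam ζ) (hα : 0 < α) (hk : SpectralGap lam k) (x y : H) :
    HasSum (fun i => lam i / (lam i + if i < k then 0 else α) ^ 2 * ⟪ζ i, x - y⟫ ^ 2)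
      (rdmdSq α k x y C) := by
  rw [hE.rdmdSq_eq hα hk]
  convert hE.hasSum_inner _ _ using 2 with i
  -- Each `ζ i` diagonalizes the normal operator, so `R` divides the `i`-th coordinate by `lam i + α
  -- 1_{i ≥ k}`, which is positive for `i < k` thanks to the gap.
  have h := hE.normalOp_eigenvector α k i (Ring.inverse (normalOp α k C ζ) (x - y))
  rw [hE.normalOp_inverse_apply hα hk] at h
  have hpos : 0 < lam i + if i < k then 0 else α := by
    have := hE.nonneg i
    split_ifs with hi
    · obtain ⟨δ, hδ, h⟩ := hk.exists_pos hE.antitone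
      have := h i hi
      have := hE.nonneg k
      linarith
    · linarith
  rw [h]
  field_simp

end IsEigenSystem

/-- The convention for operators without a gap comes from the default value `0` of `regStd`. -/
lemma rdmdSq_eq_zero {α : ℝ} {k : ℕ} {C : H →L[ℝ] H}
    (h : ¬ ∃ (lam : ℕ → ℝ) (ζ : ℕ → H), IsEigenSystem C lam ζ ∧ SpectralGap lam k) (x y : H) :
    rdmdSq α k x y C = 0 := by
  have : ∀ x, regStd α k C x = 0 := fun x => by
    rw [regStd, dif_neg]
    rintro ⟨z, lam, ζ, hE, hk, -⟩
    exact h ⟨lam, ζ, hE, hk⟩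
  simp [rdmdSq, this]

end Standardization

/-! ### Spectral theorem for positive compact operators. -/

section Existence

variable {H : Type*} [NormedAddCommGroup H] [InnerProductSpace ℝ H] [CompleteSpace H]

/-- The norm of a nonzero positive compact operator is an eigenvalue. -/
lemma exists_eigenvector_norm {T : H →L[ℝ] H} (hT : T.IsPositive) (hc : IsCompactOperator T)
    (h0 : T ≠ 0) : ∃ v, ‖v‖ = 1 ∧ T v = ‖T‖ • v := by
  have hsym : (T : H →ₗ[ℝ] H).IsSymmetric := hT.isSymmetric
  have hsr := T.spectralRadius_eq_nnnorm (𝕜 := ℝ) hT.isSelfAdjoint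
  -- Over `ℝ` this is not automatic: an empty spectrum would make the spectral radius, which is
  -- `‖T‖`, vanish.
  have hne : (spectrum ℝ T).Nonempty := by
    rw [nonempty_iff_ne_empty]
    intro he
    rw [spectralRadius, he] at hsr
    simp at hsr
    exact h0 (nnnorm_eq_zero.1 hsr.symm)
  have hN : Nontrivial H := by
    by_contra hN
    rw [not_nontrivial_iff_subsingleton] at hN
    exact h0 (Subsingleton.elim _ _)
  obtain ⟨μ, hμ, hμn⟩ := spectrum.exists_nnnorm_eq_spectralRadius_of_nonempty hne
  rw [hsr] at hμn
  have hμn : |μ| = ‖T‖ := by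
    have : ‖μ‖₊ = ‖T‖₊ := by exact_mod_cast hμn
    simpa using congrArg NNReal.toReal this
  have hμ0 : μ ≠ 0 := by
    rintro rfl
    rw [abs_zero, eq_comm, norm_eq_zero] at hμn
    exact h0 hμn
  have hev : Module.End.HasEigenvalue (T : Module.End ℝ H) μ :=
    (hc.hasEigenvalue_iff_mem_spectrum hμ0).2 hμ
  obtain ⟨w, hw⟩ := hev.exists_hasEigenvector
  have hTw : T w = μ • w := hw.apply_eq_smul
  have hw0 : 0 < ‖w‖ := norm_pos_iff.2 hw.2
  have hpos : 0 ≤ μ := by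
    have := hT.inner_nonneg_left w
    rw [hTw, real_inner_smul_left, real_inner_self_eq_norm_sq] at this
    exact nonneg_of_mul_nonneg_left this (by positivity)
  refine ⟨‖w‖⁻¹ • w, by rw [norm_smul, norm_inv, norm_norm, inv_mul_cancel₀ hw0.ne'], ?_⟩
  rw [map_smul, hTw, ← hμn, abs_of_nonneg hpos, smul_comm]

/-- In an infinite-dimensional space, a positive compact operator attains its norm on the
orthogonal complement of a finite-dimensional invariant subspace at an eigenvector. -/
lemma exists_eigenvector_orthogonal {C : H →L[ℝ] H} (hC : C.IsPositive)
    (hc : IsCompactOperator C) (hH : ¬ FiniteDimensional ℝ H) (F : Submodule ℝ H)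
    [FiniteDimensional ℝ F] (hF : ∀ x ∈ F, C x ∈ F) :
    ∃ v ∈ Fᗮ, ‖v‖ = 1 ∧ ∃ μ : ℝ, 0 ≤ μ ∧ C v = μ • v ∧ ∀ w ∈ Fᗮ, ‖C w‖ ≤ μ * ‖w‖ := by
  have hsym : (C : H →ₗ[ℝ] H).IsSymmetric := hC.isSymmetric
  have hF' : ∀ x ∈ Fᗮ, C x ∈ Fᗮ := by
    intro x hx u hu
    have : ⟪u, C x⟫ = ⟪C u, x⟫ := (hsym u x).symm
    rw [this]
    exact hx _ (hF u hu)
  let T : Fᗮ →L[ℝ] Fᗮ := C.restrict hF'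
  have hTc : IsCompactOperator T := hc.restrict' (f := (C : H →ₗ[ℝ] H)) hF'
  have hTp : T.IsPositive := by
    rw [ContinuousLinearMap.isPositive_def]
    exact ⟨fun x y => hsym x y, fun x => hC.2 x⟩
  have hT : ∃ v : Fᗮ, ‖v‖ = 1 ∧ T v = ‖T‖ • v := by
    rcases eq_or_ne T 0 with h0 | h0
    -- Any unit vector of `Fᗮ` serves when `T = 0`. This pads finite-rank operators with zero
    -- eigenvalues, so that the system is indexed by all of `ℕ`.
    · have : Nontrivial Fᗮ := by
        rw [Submodule.nontrivial_iff_ne_bot]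
        intro hb
        rw [Submodule.orthogonal_eq_bot_iff] at hb
        subst hb
        exact hH (Module.Finite.equiv Submodule.topEquiv)
      obtain ⟨v, hv⟩ := exists_norm_eq Fᗮ zero_le_one
      have hn : ‖T‖ = 0 := by rw [h0]; exact ContinuousLinearMap.opNorm_zero
      exact ⟨v, hv, by rw [hn, zero_smul, h0]; rfl⟩
    · exact exists_eigenvector_norm hTp hTc h0
  obtain ⟨v, hv, hTv⟩ := hT
  refine ⟨v, v.2, hv, ‖T‖, T.opNorm_nonneg, congrArg Subtype.val hTv, fun w hw => ?_⟩
  exact T.le_opNorm ⟨w, hw⟩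

/-- **Spectral theorem**: a positive compact operator on an infinite-dimensional Hilbert space has
a system of eigenpairs. -/
theorem exists_isEigenSystem {C : H →L[ℝ] H} (hC : C.IsPositive) (hc : IsCompactOperator C)
    (hH : ¬ FiniteDimensional ℝ H) : ∃ lam ζ, IsEigenSystem C lam ζ := by
  -- Deflation: a state `F` is the span of the eigenvectors found so far, enlarged at each step by a
  -- top eigenvector of `C` on `Fᗮ`.
  let S := {F : Submodule ℝ H // FiniteDimensional ℝ F ∧ ∀ x ∈ F, C x ∈ F}
  have step : ∀ F : S, ∃ p : H × ℝ, p.1 ∈ F.1ᗮ ∧ ‖p.1‖ = 1 ∧ 0 ≤ p.2 ∧ C p.1 = p.2 • p.1 ∧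
      ∀ w ∈ F.1ᗮ, ‖C w‖ ≤ p.2 * ‖w‖ := by
    rintro ⟨F, hfd, hF⟩
    obtain ⟨v, hv, hv1, μ, hμ, hCv, h⟩ := exists_eigenvector_orthogonal hC hc hH F hF
    exact ⟨(v, μ), hv, hv1, hμ, hCv, h⟩
  choose p hpF hp1 hp0 hpC hpn using step
  have hnext : ∀ F : S, FiniteDimensional ℝ (F.1 ⊔ ℝ ∙ (p F).1 : Submodule ℝ H) ∧
      ∀ x ∈ F.1 ⊔ ℝ ∙ (p F).1, C x ∈ F.1 ⊔ ℝ ∙ (p F).1 := by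
    rintro F
    have := F.2.1
    refine ⟨inferInstance, fun x hx => ?_⟩
    obtain ⟨u, hu, w, hw, rfl⟩ := Submodule.mem_sup.1 hx
    obtain ⟨c, rfl⟩ := Submodule.mem_span_singleton.1 hw
    rw [map_add, map_smul, hpC, smul_comm]
    exact Submodule.add_mem_sup (F.2.2 u hu) (Submodule.smul_mem _ _
      (Submodule.smul_mem _ _ (Submodule.mem_span_singleton_self _)))
  let next : S → S := fun F => ⟨F.1 ⊔ ℝ ∙ (p F).1, hnext F⟩
  let s₀ : S := ⟨⊥, inferInstance, fun x hx => by
    rw [(Submodule.mem_bot ℝ).1 hx, map_zero]; exact Submodule.zero_mem _⟩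
  let F : ℕ → S := fun n => next^[n] s₀
  have hFs : ∀ n, (F (n + 1)).1 = (F n).1 ⊔ ℝ ∙ (p (F n)).1 := fun n => by
    simp only [F, Function.iterate_succ_apply']; rfl
  let ζ : ℕ → H := fun n => (p (F n)).1
  let lam : ℕ → ℝ := fun n => (p (F n)).2
  have hmono : Monotone fun n => (F n).1 := monotone_nat_of_le_succ fun n => by
    rw [hFs]; exact le_sup_left
  have hζF : ∀ n, ζ n ∈ (F (n + 1)).1 := fun n => by
    rw [hFs]; exact Submodule.mem_sup_right (Submodule.mem_span_singleton_self _)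
  have hlt : ∀ m n, m < n → ⟪ζ m, ζ n⟫ = 0 := fun m n hmn =>
    hpF (F n) _ (hmono (Nat.succ_le_of_lt hmn) (hζF m))
  have horth : Orthonormal ℝ ζ := by
    refine ⟨fun n => hp1 _, fun m n hmn => ?_⟩
    rcases lt_or_gt_of_ne hmn with h | h
    · exact hlt m n h
    · rw [real_inner_comm]; exact hlt n m h
  have hCζ : ∀ n, C (ζ n) = lam n • ζ n := fun n => hpC _
  have hnonneg : ∀ n, 0 ≤ lam n := fun n => hp0 _
  have hbound : ∀ n, ∀ w ∈ (F n).1ᗮ, ‖C w‖ ≤ lam n * ‖w‖ := fun n => hpn _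
  have hanti : Antitone lam := antitone_nat_of_succ_le fun n => by
    have h := hbound n (ζ (n + 1)) (Submodule.orthogonal_le (hmono n.le_succ) (hpF _))
    rwa [hCζ, norm_smul, horth.1, mul_one, mul_one, Real.norm_of_nonneg (hnonneg _)] at h
  -- If the eigenvalues stayed above `L > 0`, the vectors `C (ζ n)` would be pairwise orthogonal of
  -- norm at least `L`, hence more than `L` apart, against compactness.
  have hlim : Tendsto lam atTop (𝓝 0) := by
    have hbdd : BddBelow (range lam) := ⟨0, by rintro _ ⟨n, rfl⟩; exact hnonneg n⟩
    have hL := tendsto_atTop_ciInf hanti hbdd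
    set L := ⨅ n, lam n
    have hLle : ∀ n, L ≤ lam n := fun n => ciInf_le hbdd n
    have hL0 : 0 ≤ L := le_ciInf hnonneg
    suffices L = 0 by rwa [this] at hL
    by_contra hne
    have hLpos : 0 < L := lt_of_le_of_ne hL0 (Ne.symm hne)
    obtain ⟨K, hK, hKs⟩ := IsCompactOperator.image_closedBall_subset_compact
      (f := (C : H →ₗ[ℝ] H)) hc 1
    have hmem : ∀ n, C (ζ n) ∈ K := fun n =>
      hKs ⟨ζ n, by simp [horth.1 n], rfl⟩
    obtain ⟨a, -, φ, hφ, hconv⟩ := hK.tendsto_subseq hmem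
    have hcau := hconv.cauchySeq
    rw [Metric.cauchySeq_iff'] at hcau
    obtain ⟨N, hN⟩ := hcau L hLpos
    have h1 := hN (N + 1) (Nat.le_succ N)
    have hne' : φ (N + 1) ≠ φ N := (hφ (Nat.lt_succ_self N)).ne'
    have h2 : ‖C (ζ (φ (N + 1))) - C (ζ (φ N))‖ ^ 2
        = lam (φ (N + 1)) ^ 2 + lam (φ N) ^ 2 := by
      rw [norm_sub_sq_real, hCζ, hCζ, real_inner_smul_left, real_inner_smul_right,
        horth.2 hne', norm_smul, norm_smul, horth.1, horth.1]
      simp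
    simp only [Function.comp_apply, dist_eq_norm] at h1
    have h3 : L ^ 2 ≤ lam (φ (N + 1)) ^ 2 := pow_le_pow_left₀ hL0 (hLle _) 2
    have h4 := pow_lt_pow_left₀ h1 (norm_nonneg _) two_ne_zero
    nlinarith [sq_nonneg (lam (φ N))]
  refine ⟨lam, ζ, horth, hanti, hnonneg, fun f => ?_⟩
  have hr : ∀ n, f - ∑ i ∈ Finset.range n, ⟪ζ i, f⟫ • ζ i ∈ (F n).1ᗮ := by
    intro n
    induction n with
    | zero =>
      have : (F 0).1 = ⊥ := rfl
      rw [this, Submodule.bot_orthogonal_eq_top]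
      exact Submodule.mem_top
    | succ n ih =>
      rw [hFs, ← Submodule.inf_orthogonal, Submodule.mem_inf]
      constructor
      · rw [Finset.sum_range_succ, ← sub_sub]
        exact Submodule.sub_mem _ ih (Submodule.smul_mem _ _ (hpF _))
      · rw [Submodule.mem_orthogonal_singleton_iff_inner_right]
        change ⟪ζ n, _⟫ = 0
        rw [inner_sub_right, horth.inner_right_sum _ (Finset.self_mem_range_succ n), sub_self]
  have hsum : Summable fun i => (lam i * ⟪ζ i, f⟫) • ζ i := by
    refine summable_smul_of_summable_sq horth ?_
    refine Summable.of_nonneg_of_le (fun i => sq_nonneg _) (fun i => ?_)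
      ((horth.inner_products_summable (x := f)).mul_left (lam 0 ^ 2))
    rw [mul_pow, Real.norm_eq_abs, sq_abs]
    exact mul_le_mul_of_nonneg_right
      (pow_le_pow_left₀ (hnonneg i) (hanti (Nat.zero_le i)) 2) (sq_nonneg _)
  -- The error is `C` applied to a residual in `(F n).1ᗮ` of norm at most `‖f‖`, hence at most `lam
  -- n * ‖f‖`. `hsum` upgrades this to unconditional convergence.
  have hten : Tendsto (fun n => ∑ i ∈ Finset.range n, (lam i * ⟪ζ i, f⟫) • ζ i) atTop
      (𝓝 (C f)) := by
    rw [tendsto_iff_norm_sub_tendsto_zero]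
    refine squeeze_zero (fun n => norm_nonneg _) (fun n => ?_)
      (g := fun n => lam n * ‖f‖) (by simpa using hlim.mul_const ‖f‖)
    have e1 : C f - ∑ i ∈ Finset.range n, (lam i * ⟪ζ i, f⟫) • ζ i
        = C (f - ∑ i ∈ Finset.range n, ⟪ζ i, f⟫ • ζ i) := by
      rw [map_sub, map_sum]
      congr 1
      refine Finset.sum_congr rfl fun i _ => ?_
      rw [map_smul, hCζ, smul_smul, mul_comm]
    rw [norm_sub_rev, e1]
    refine (hbound n _ (hr n)).trans (mul_le_mul_of_nonneg_left ?_ (hnonneg n))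
    rw [← projW_apply horth]
    exact Submodule.norm_starProjection_apply_le _ _
  have := hsum.hasSum
  rwa [tendsto_nhds_unique this.tendsto_sum_nat hten] at this

end Existence

/-! ### Continuity, measurability and convergence of the plug-in distance. -/

section Stability

variable {H : Type*} [NormedAddCommGroup H] [InnerProductSpace ℝ H]

/-- The set of positive compact operators. -/
def posCompact (H : Type*) [NormedAddCommGroup H] [InnerProductSpace ℝ H] : Set (H →L[ℝ] H) :=
  {C | C.IsPositive ∧ IsCompactOperator C}

/-- The set of positive compact operators whose `k`-th eigenvalue is separated from the next. -/
def gapSet (H : Type*) [NormedAddCommGroup H] [InnerProductSpace ℝ H] (k : ℕ) :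
    Set (H →L[ℝ] H) :=
  {C | C ∈ posCompact H ∧ ∃ lam ζ, IsEigenSystem C lam ζ ∧ SpectralGap lam k}

/-- Needed for the measurability of `gapSet`, and to pass positivity and compactness from the
estimators to their limit. -/
lemma isClosed_posCompact [CompleteSpace H] : IsClosed (posCompact H) := by
  refine IsClosed.inter ?_ isClosed_setOfPred_isCompactOperator
  have : {C : H →L[ℝ] H | C.IsPositive}
      = (⋂ x, ⋂ y, {C : H →L[ℝ] H | ⟪C x, y⟫ = ⟪x, C y⟫}) ∩
        ⋂ x, {C : H →L[ℝ] H | 0 ≤ ⟪C x, x⟫} := by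
    ext C
    simp only [mem_inter_iff, mem_iInter, mem_ofPred_eq]
    rw [ContinuousLinearMap.isPositive_def]
    rfl
  change IsClosed {C : H →L[ℝ] H | C.IsPositive}
  rw [this]
  refine IsClosed.inter (isClosed_iInter fun x => isClosed_iInter fun y => ?_)
    (isClosed_iInter fun x => ?_)
  · exact isClosed_eq (by fun_prop) (by fun_prop)
  · exact isClosed_le (by fun_prop) (by fun_prop)

/-- Within distance `δ / 2`, Weyl moves each of the two eigenvalues bounding the gap by less than
half of it. -/
lemma gapSet_mem_nhdsWithin [CompleteSpace H] (hH : ¬ FiniteDimensional ℝ H) {k : ℕ}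
    {C : H →L[ℝ] H} (hC : C ∈ gapSet H k) : gapSet H k ∈ 𝓝[posCompact H] C := by
  obtain ⟨-, lam, ζ, hE, hk⟩ := hC
  obtain ⟨δ, hδ, h⟩ := hk.exists_pos hE.antitone
  rw [mem_nhdsWithin_iff_eventually]
  filter_upwards [Metric.ball_mem_nhds C (half_pos hδ)] with C' hC' hK
  obtain ⟨lam', ζ', hE'⟩ := exists_isEigenSystem hK.1 hK.2 hH
  refine ⟨hK, lam', ζ', hE', ?_⟩
  rcases Nat.eq_zero_or_pos k with h0 | h0
  · exact Or.inl h0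
  · right
    rw [Metric.mem_ball, dist_eq_norm] at hC'
    have h1 := hE.eigenvalue_le_add_norm_sub hE' (k - 1)
    have h2 := hE'.eigenvalue_le_add_norm_sub hE k
    have h3 := h (k - 1) (by omega)
    rw [norm_sub_rev] at h2
    linarith

/-- Relatively open in a closed set, hence Borel. -/
lemma gapSet_eq_inter [CompleteSpace H] (hH : ¬ FiniteDimensional ℝ H) (k : ℕ) :
    gapSet H k = posCompact H ∩ interior (gapSet H k ∪ (posCompact H)ᶜ) := by
  ext C
  constructor
  · intro hC
    refine ⟨hC.1, mem_interior_iff_mem_nhds.2 ?_⟩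
    filter_upwards [mem_nhdsWithin_iff_eventually.1 (gapSet_mem_nhdsWithin hH hC)] with C' h
    by_cases h' : C' ∈ posCompact H
    · exact Or.inl (h h')
    · exact Or.inr h'
  · rintro ⟨hK, hC⟩
    exact (interior_subset hC).resolve_right fun h => h hK

lemma measurableSet_gapSet [CompleteSpace H] [MeasurableSpace (H →L[ℝ] H)]
    [BorelSpace (H →L[ℝ] H)] (hH : ¬ FiniteDimensional ℝ H) (k : ℕ) :
    MeasurableSet (gapSet H k) := by
  rw [gapSet_eq_inter hH]
  exact isClosed_posCompact.measurableSet.inter isOpen_interior.measurableSet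

open Classical in
/-- The spectral projection `W(k)` as a function of the operator. -/
noncomputable def gapProj [CompleteSpace H] (k : ℕ) (C : H →L[ℝ] H) : H →L[ℝ] H :=
  if h : ∃ (ζ : ℕ → H) (lam : ℕ → ℝ), IsEigenSystem C lam ζ then projW h.choose k else 0

lemma IsEigenSystem.gapProj_eq [CompleteSpace H] {C : H →L[ℝ] H} {lam : ℕ → ℝ} {ζ : ℕ → H}
    (hE : IsEigenSystem C lam ζ) {k : ℕ} (hk : SpectralGap lam k) :
    gapProj k C = projW ζ k := by
  have h : ∃ (ζ : ℕ → H) (lam : ℕ → ℝ), IsEigenSystem C lam ζ := ⟨ζ, lam, hE⟩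
  rw [gapProj, dif_pos h]
  obtain ⟨lam', hE'⟩ := h.choose_spec
  exact (hE.projW_unique hE' hk).symm

lemma continuousOn_gapProj [CompleteSpace H] (k : ℕ) :
    ContinuousOn (gapProj k) (gapSet H k) := by
  rintro C ⟨-, lam, ζ, hE, hk⟩
  obtain ⟨δ, hδ, h⟩ := hk.exists_pos hE.antitone
  rw [ContinuousWithinAt, tendsto_iff_norm_sub_tendsto_zero]
  -- The modulus of continuity is the Davis–Kahan bound, meaningful once `‖C' - C‖ < δ`.
  have hcont : ContinuousAt (fun C' : H →L[ℝ] H => 2 * k * ‖C' - C‖ / (δ - ‖C' - C‖)) C := by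
    refine ContinuousAt.div (by fun_prop) (by fun_prop) ?_
    simpa using hδ.ne'
  have hlim := hcont.tendsto
  simp only [sub_self, norm_zero, mul_zero, zero_div] at hlim
  refine squeeze_zero' (Eventually.of_forall fun _ => norm_nonneg _) ?_
    (hlim.mono_left nhdsWithin_le_nhds)
  filter_upwards [self_mem_nhdsWithin, mem_nhdsWithin_of_mem_nhds (Metric.ball_mem_nhds C hδ)]
    with C' hC' hb
  obtain ⟨-, lam', ζ', hE', hk'⟩ := hC'
  rw [Metric.mem_ball, dist_eq_norm] at hb
  rw [hE.gapProj_eq hk, hE'.gapProj_eq hk', le_div_iff₀ (sub_pos.2 hb), mul_comm,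
    norm_sub_rev (projW ζ' k)]
  exact hE.gap_mul_norm_projW_sub_le hE' h

/-- The regularized Mahalanobis distance depends continuously on the operator, as long as the
spectral gap is preserved. -/
lemma continuousOn_rdmdSq [CompleteSpace H] {α : ℝ} (hα : 0 < α) (k : ℕ) :
    ContinuousOn (fun p : (H →L[ℝ] H) × H => rdmdSq α k p.2 0 p.1) (gapSet H k ×ˢ univ) := by
  have hN : ContinuousOn (fun p : (H →L[ℝ] H) × H => p.1 + α • gapProj k p.1)
      (gapSet H k ×ˢ univ) :=
    continuousOn_fst.add (((continuousOn_gapProj k).comp (g := gapProj k) continuousOn_fst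
      fun p (hp : p ∈ gapSet H k ×ˢ univ) => hp.1).const_smul α)
  have hR : ContinuousOn (fun p : (H →L[ℝ] H) × H => Ring.inverse (p.1 + α • gapProj k p.1))
      (gapSet H k ×ˢ univ) := by
    intro p hp
    obtain ⟨-, lam, ζ, hE, hk⟩ := hp.1
    have hu := hE.isUnit_normalOp hα hk
    have := NormedRing.inverse_continuousAt hu.unit
    refine ContinuousAt.comp_continuousWithinAt (g := Ring.inverse) ?_ (hN p hp)
    rw [hE.gapProj_eq hk]
    exact this
  have hRp : ContinuousOn
      (fun p : (H →L[ℝ] H) × H => Ring.inverse (p.1 + α • gapProj k p.1) p.2)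
      (gapSet H k ×ˢ univ) := hR.clm_apply continuousOn_snd
  refine ((continuousOn_fst.clm_apply hRp).inner hRp).congr ?_
  rintro p hp
  obtain ⟨-, lam, ζ, hE, hk⟩ := hp.1
  change rdmdSq α k p.2 0 p.1 = _
  rw [hE.rdmdSq_eq hα hk, sub_zero, normalOp, ← hE.gapProj_eq hk]

lemma rdmdSq_eq_rdmdSq_sub [CompleteSpace H] {α : ℝ} (hα : 0 < α) {k : ℕ} (C : H →L[ℝ] H)
    (x y : H) : rdmdSq α k x y C = rdmdSq α k (x - y) 0 C := by
  by_cases h : ∃ (lam : ℕ → ℝ) (ζ : ℕ → H), IsEigenSystem C lam ζ ∧ SpectralGap lam k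
  · obtain ⟨lam, ζ, hE, hk⟩ := h
    rw [hE.rdmdSq_eq hα hk, hE.rdmdSq_eq hα hk, sub_zero]
  · rw [rdmdSq_eq_zero h, rdmdSq_eq_zero h]

variable {Ω : Type*} [MeasurableSpace Ω] {P : Measure Ω}

lemma aemeasurable_rdmdSq [CompleteSpace H] [MeasurableSpace H] [BorelSpace H]
    [SecondCountableTopology H] (hH : ¬ FiniteDimensional ℝ H) {α : ℝ} (hα : 0 < α) (k : ℕ)
    {X Y : Ω → H} (hX : AEMeasurable X P) (hY : AEMeasurable Y P) {T : Ω → (H →L[ℝ] H)}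
    (hT : AEStronglyMeasurable T P) (hTpos : ∀ᵐ ω ∂P, T ω ∈ posCompact H) :
    AEMeasurable (fun ω => rdmdSq α k (X ω) (Y ω) (T ω)) P := by
  classical
  -- The operator space need not be separable, so the Borel σ-algebra of the product may exceed the
  -- product σ-algebra. Strong measurability of `T` makes the pair measurable for the former.
  let _ : MeasurableSpace ((H →L[ℝ] H) × H) := borel _
  have : BorelSpace ((H →L[ℝ] H) × H) := ⟨rfl⟩
  have hg : AEMeasurable (fun ω => (T ω, X ω - Y ω)) P :=
    (hT.prodMk (hX.sub hY).aestronglyMeasurable).aemeasurable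
  have hS : MeasurableSet (gapSet H k ×ˢ (univ : Set H)) := by
    let _ : MeasurableSpace (H →L[ℝ] H) := borel _
    have : BorelSpace (H →L[ℝ] H) := ⟨rfl⟩
    rw [prod_univ]
    exact continuous_fst.measurable (measurableSet_gapSet hH k)
  -- The distance is continuous on the Borel gap set and `0` at the other positive compact
  -- operators.
  have hΦ : Measurable ((gapSet H k ×ˢ (univ : Set H)).piecewise
      (fun p => rdmdSq α k p.2 0 p.1) fun _ => (0 : ℝ)) :=
    (continuousOn_rdmdSq hα k).measurable_piecewise continuousOn_const hS
  refine (hΦ.comp_aemeasurable hg).congr ?_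
  filter_upwards [hTpos] with ω hω
  simp only [Function.comp_apply]
  rw [rdmdSq_eq_rdmdSq_sub hα]
  by_cases h : T ω ∈ gapSet H k
  · exact piecewise_eq_of_mem _ _ _ ⟨h, mem_univ _⟩
  · rw [piecewise_eq_of_notMem _ _ _ fun h' => h h'.1, rdmdSq_eq_zero fun h' => h ⟨hω, h'⟩]

/-- Plug-in regularized Mahalanobis distances converge almost surely, hence in distribution. -/
theorem tendstoInDistribution_rdmdSq [CompleteSpace H] [MeasurableSpace H] [BorelSpace H]
    [SecondCountableTopology H] [IsProbabilityMeasure P] {α : ℝ} (hα : 0 < α) {k : ℕ}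
    {C : H →L[ℝ] H} {lam : ℕ → ℝ} {ζ : ℕ → H} (hE : IsEigenSystem C lam ζ)
    (hk : SpectralGap lam k) {X : Ω → H} (hX : AEMeasurable X P) {m : H} {μ : ℕ → Ω → H}
    (hμm : ∀ n, AEMeasurable (μ n) P) (hμ : StronglyConsistent P μ m)
    {T : ℕ → Ω → (H →L[ℝ] H)} (hTm : ∀ n, AEStronglyMeasurable (T n) P)
    (hTpos : ∀ n, ∀ᵐ ω ∂P, T n ω ∈ posCompact H) (hT : StronglyConsistent P T C) :
    TendstoInDistribution (fun n ω => rdmdSq α k (X ω) (μ n ω) (T n ω)) atTop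
      (fun ω => rdmdSq α k (X ω) m C) (fun _ => P) P := by
  have hH : ¬ FiniteDimensional ℝ H := fun h => by
    have : Finite ℕ := hE.orthonormal.linearIndependent.finite
    exact not_finite ℕ
  have hall := ae_all_iff.2 hTpos
  -- `C` inherits positivity and compactness from one sample path along which the estimators
  -- converge.
  have hCpos : C ∈ posCompact H := by
    obtain ⟨ω, h1, h2⟩ := (hall.and hT).exists
    exact isClosed_posCompact.mem_of_tendsto h2 (Eventually.of_forall h1)
  have hC : C ∈ gapSet H k := ⟨hCpos, lam, ζ, hE, hk⟩
  have hlim : ∀ᵐ ω ∂P, Tendsto (fun n => rdmdSq α k (X ω) (μ n ω) (T n ω)) atTop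
      (𝓝 (rdmdSq α k (X ω) m C)) := by
    filter_upwards [hall, hT, hμ] with ω hp hTω hμω
    have hmem : ∀ᶠ n in atTop, T n ω ∈ gapSet H k :=
      (tendsto_nhdsWithin_iff.2 ⟨hTω, Eventually.of_forall hp⟩).eventually
        (gapSet_mem_nhdsWithin hH hC)
    have hpair : Tendsto (fun n => (T n ω, X ω - μ n ω)) atTop
        (𝓝[gapSet H k ×ˢ univ] (C, X ω - m)) :=
      tendsto_nhdsWithin_iff.2 ⟨hTω.prodMk_nhds (tendsto_const_nhds.sub hμω),
        hmem.mono fun n hn => ⟨hn, mem_univ _⟩⟩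
    have hlim : Tendsto (fun p : (H →L[ℝ] H) × H => rdmdSq α k p.2 0 p.1)
        (𝓝[gapSet H k ×ˢ univ] (C, X ω - m)) (𝓝 (rdmdSq α k (X ω - m) 0 C)) :=
      continuousOn_rdmdSq hα k (C, X ω - m) ⟨hC, mem_univ _⟩
    rw [rdmdSq_eq_rdmdSq_sub hα C (X ω) m]
    refine (hlim.comp hpair).congr fun n => ?_
    exact (rdmdSq_eq_rdmdSq_sub hα (T n ω) (X ω) (μ n ω)).symm
  refine tendstoInDistribution_of_ae_tendsto
    (fun n => aemeasurable_rdmdSq hH hα k hX (hμm n) (hTm n) (hTpos n))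
    (aemeasurable_rdmdSq hH hα k hX aemeasurable_const aestronglyMeasurable_const
      (Eventually.of_forall fun _ => hCpos)) hlim

end Stability

/-! ### Head sum and tail of an independent sequence. -/

section ProductLaws

lemma chiSq_one_eq : chiSq 1 = (gaussianReal 0 1).map (fun z => z ^ 2) := by
  have h := (measurePreserving_funUnique (gaussianReal 0 1) (Fin 1)).map_eq
  rw [chiSq]
  conv_rhs => rw [← h]
  rw [Measure.map_map (by fun_prop) (by fun_prop)]
  congr 1
  ext z
  simp

instance (k : ℕ) : IsProbabilityMeasure (chiSq k) :=
  Measure.isProbabilityMeasure_map (Measurable.aemeasurable (by fun_prop))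

lemma map_sum_pi_chiSq (k : ℕ) :
    (Measure.pi fun _ : Fin k => chiSq 1).map (fun z => ∑ i, z i) = chiSq k := by
  have h : (Measure.pi fun _ : Fin k => chiSq 1)
      = (Measure.pi fun _ : Fin k => gaussianReal 0 1).map (fun z i => z i ^ 2) := by
    rw [chiSq_one_eq]
    have : IsProbabilityMeasure ((gaussianReal 0 1).map fun z => z ^ 2) :=
      Measure.isProbabilityMeasure_map (by fun_prop)
    rw [Measure.pi_map_pi (f := fun _ z => z ^ 2) (fun i => by fun_prop)]
  rw [h, Measure.map_map (by fun_prop) (by fun_prop)]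
  rfl

variable (ν : ℕ → Measure ℝ) [∀ i, IsProbabilityMeasure (ν i)] (k : ℕ)

/-- The two functions are measurable for the σ-algebras of the disjoint index blocks `Iio k` and
`Ici k`. -/
lemma indepFun_sum_range_tail :
    IndepFun (fun w : ℕ → ℝ => ∑ i ∈ Finset.range k, w i) (fun w i => w (k + i))
      (Measure.infinitePi ν) := by
  have hi : iIndepFun (fun i (w : ℕ → ℝ) => w i) (Measure.infinitePi ν) :=
    iIndepFun_infinitePi (X := fun _ x => x) fun i => measurable_id
  have h := indep_iSup_of_disjoint (S := Iio k) (T := Ici k)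
    (fun i => (measurable_pi_apply i).comap_le) hi (Iio_disjoint_Ici le_rfl)
  rw [IndepFun_iff_Indep]
  refine indep_of_indep_of_le_left (indep_of_indep_of_le_right h ?_) ?_
  · rw [MeasurableSpace.pi, MeasurableSpace.comap_iSup]
    refine iSup_le fun i => ?_
    rw [MeasurableSpace.comap_comp]
    exact le_iSup₂_of_le (k + i) (Nat.le_add_right k i) le_rfl
  · rw [← measurable_iff_comap_le]
    refine Finset.measurable_fun_sum _ fun i hi => ?_
    rw [measurable_iff_comap_le]
    exact le_iSup₂_of_le i (Finset.mem_range.1 hi) le_rfl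

lemma infinitePi_map_sum_range (hν : ∀ i < k, ν i = chiSq 1) :
    (Measure.infinitePi ν).map (fun w : ℕ → ℝ => ∑ i ∈ Finset.range k, w i) = chiSq k := by
  have h := Measure.map_infinitePi_infinitePi_of_inj (P := ν) (f := fun i : Fin k => (i : ℕ))
    Fin.val_injective
  have e : (fun i : Fin k => ν i) = fun _ => chiSq 1 := funext fun i => hν i i.2
  rw [Measure.infinitePi_eq_pi (μ := fun i : Fin k => ν i), e] at h
  rw [← map_sum_pi_chiSq, ← h, Measure.map_map (by fun_prop) (by fun_prop)]
  congr 1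
  ext w
  simp [Finset.sum_range]

/-- The joint law of a partial sum of squares and of the remaining coordinates. -/
lemma infinitePi_map_sum_range_prod_tail (hν : ∀ i < k, ν i = chiSq 1) :
    (Measure.infinitePi ν).map
        (fun w : ℕ → ℝ => (∑ i ∈ Finset.range k, w i, fun i => w (k + i)))
      = (chiSq k).prod (Measure.infinitePi fun i => ν (k + i)) := by
  rw [(indepFun_iff_map_prod_eq_prod_map_map (Measurable.aemeasurable (by fun_prop))
    (Measurable.aemeasurable (by fun_prop))).1
    (indepFun_sum_range_tail ν k), infinitePi_map_sum_range ν k hν]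
  congr 1
  exact Measure.map_infinitePi_infinitePi_of_inj (P := ν) (f := fun i => k + i)
    (add_right_injective k)

end ProductLaws

/-! ### Measurability of sums of nonnegative series. -/

section NonnegSeries

/-- The sum of a series of nonnegative terms, as an extended nonnegative number. -/
noncomputable def ennrealSum (t : ℕ → ℝ) : ℝ≥0∞ := ∑' i, ENNReal.ofReal (t i)

lemma measurable_ennrealSum : Measurable ennrealSum :=
  Measurable.tsum fun i => (measurable_pi_apply i).ennreal_ofReal

/-- The set of nonnegative summable sequences. -/
def nonnegSummable : Set (ℕ → ℝ) := {t | (∀ i, 0 ≤ t i) ∧ Summable t}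

lemma nonnegSummable_eq :
    nonnegSummable = (⋂ i, {t | 0 ≤ t i}) ∩ ennrealSum ⁻¹' {⊤}ᶜ := by
  ext t
  simp only [nonnegSummable, mem_inter_iff, mem_iInter, mem_ofPred_eq, mem_preimage,
    mem_compl_iff, mem_singleton_iff, ennrealSum]
  refine and_congr_right fun h => ⟨fun hs => hs.tsum_ofReal_ne_top, fun hs => ?_⟩
  have := ENNReal.tsum_coe_ne_top_iff_summable.1 hs
  rw [← NNReal.summable_coe] at this
  simpa [h] using this

/-- This lets almost sure summability pass between random sequences with the same law. -/
lemma measurableSet_nonnegSummable : MeasurableSet nonnegSummable := by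
  rw [nonnegSummable_eq]
  refine (MeasurableSet.iInter fun i => ?_).inter
    (measurable_ennrealSum (measurableSet_singleton _).compl)
  exact measurableSet_le measurable_const (measurable_pi_apply i)

/-- Replaces the real sum by a functional that is measurable on all sequences. -/
lemma toReal_ennrealSum {t : ℕ → ℝ} (ht : t ∈ nonnegSummable) :
    (ennrealSum t).toReal = ∑' i, t i := by
  rw [ennrealSum, ← ENNReal.ofReal_tsum_of_nonneg ht.1 ht.2,
    ENNReal.toReal_ofReal (tsum_nonneg ht.1)]

end NonnegSeries

lemma IsMean.integral_inner_eq_zero {H : Type*} [NormedAddCommGroup H] [InnerProductSpace ℝ H]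
    {Ω : Type*} [MeasurableSpace Ω] {P : Measure Ω} {X : Ω → H} (hm : IsMean P X 0) (f : H) :
    ∫ ω, ⟪f, X ω⟫ ∂P = 0 :=
  (integral_congr_ae (ae_of_all _ fun _ => real_inner_comm _ _)).trans
    ((hm f).2.symm.trans (inner_zero_left f))

/-! ### Law of the distance of a Gaussian element. -/

section Law

variable {H : Type*} [NormedAddCommGroup H] [InnerProductSpace ℝ H]
  [MeasurableSpace H] [BorelSpace H] {Ω : Type*} [MeasurableSpace Ω] {P : Measure Ω}
  {X : Ω → H} {C : H →L[ℝ] H} {lam : ℕ → ℝ} {ζ : ℕ → H}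

/-- The coordinates of a centred Gaussian element with respect to the eigenvectors of its
covariance operator are independent. -/
lemma iIndepFun_inner_eigenvector (hX : HasGaussianLaw X P) (hm : IsMean P X 0)
    (hC : IsCovariance P X 0 C) (hE : IsEigenSystem C lam ζ) :
    iIndepFun (fun i ω => ⟪ζ i, X ω⟫) P := by
  refine iIndepFun_iff_finset.2 fun s => ?_
  have hs : HasGaussianLaw (fun ω (i : s) => ⟪ζ i, X ω⟫) P :=
    hX.map_fun (ContinuousLinearMap.pi fun i : s => innerSL ℝ (ζ i))
  refine hs.iIndepFun_of_covariance_eq_zero fun i j hij => ?_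
  have h := (hC (ζ i) (ζ j)).2
  rw [hE.apply_eigenvector, real_inner_smul_left,
    hE.orthonormal.2 (fun h => hij (Subtype.ext h)), mul_zero, eq_comm] at h
  simp only [covariance, hm.integral_inner_eq_zero]
  simpa only [sub_zero, real_inner_comm] using h

lemma map_inner_eigenvector (hX : HasGaussianLaw X P) (hm : IsMean P X 0)
    (hC : IsCovariance P X 0 C) (hE : IsEigenSystem C lam ζ) (i : ℕ) :
    P.map (fun ω => ⟪ζ i, X ω⟫) = gaussianReal 0 (lam i).toNNReal := by
  have hg : HasGaussianLaw (fun ω => ⟪ζ i, X ω⟫) P := hX.map_fun (innerSL ℝ (ζ i))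
  have hm0 := hm.integral_inner_eq_zero (ζ i)
  rw [hg.map_eq_gaussianReal, hm0, variance_of_integral_eq_zero hg.aemeasurable hm0]
  have h := (hC (ζ i) (ζ i)).2
  rw [hE.apply_eigenvector, real_inner_smul_left, real_inner_self_eq_norm_sq,
    hE.orthonormal.1, one_pow, mul_one] at h
  rw [h]
  simp only [sub_zero, real_inner_comm, sq]

/-- Writing the variable as `√l` times a standard normal, instead of dividing by `√l`, covers `l =
0`. -/
lemma map_mul_sq_gaussianReal {l c : ℝ} (hl : 0 ≤ l) :
    (gaussianReal 0 l.toNNReal).map (fun z => c * z ^ 2)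
      = (chiSq 1).map (fun z => c * l * z) := by
  have h : gaussianReal 0 l.toNNReal = (gaussianReal 0 1).map (√l * ·) := by
    rw [gaussianReal_map_const_mul, mul_zero, mul_one]
    congr 1
    ext
    simp [Real.sq_sqrt hl, Real.coe_toNNReal _ hl]
  rw [h, chiSq_one_eq, Measure.map_map (by fun_prop) (by fun_prop),
    Measure.map_map (by fun_prop) (by fun_prop)]
  congr 1
  ext z
  simp only [Function.comp_apply, mul_pow, Real.sq_sqrt hl]
  ring

variable {Ω' : Type*} [MeasurableSpace Ω'] {P' : Measure Ω'} [IsProbabilityMeasure P']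

/-- The law of the regularized Mahalanobis distance of a centred Gaussian element. -/
theorem identDistrib_rdmdSq [CompleteSpace H] [IsProbabilityMeasure P]
    (hX : HasGaussianLaw X P) (hm : IsMean P X 0)
    (hC : IsCovariance P X 0 C) (hE : IsEigenSystem C lam ζ) {α : ℝ} (hα : 0 < α) {k : ℕ}
    (hk : SpectralGap lam k) {y : Ω' → ℝ} {η : ℕ → Ω' → ℝ} (hy : HasLaw y (chiSq k) P')
    (hη : ∀ i, HasLaw (η i) (chiSq 1) P') (hη_indep : iIndepFun η P')
    (hyη_indep : IndepFun y (fun ω' i => η i ω') P') :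
    (∀ᵐ ω' ∂P', Summable fun i : ℕ =>
      lam (k + i) ^ 2 / (lam (k + i) + α) ^ 2 * η (k + i) ω') ∧
    IdentDistrib (fun ω => rdmdSq α k (X ω) 0 C)
      (fun ω' => y ω' + ∑' i : ℕ,
        lam (k + i) ^ 2 / (lam (k + i) + α) ^ 2 * η (k + i) ω') P P' := by
  set c : ℕ → ℝ := fun i => lam i / (lam i + if i < k then 0 else α) ^ 2 with hc
  set v : ℕ → Ω → ℝ := fun i ω => c i * ⟪ζ i, X ω⟫ ^ 2 with hv
  have hc0 : ∀ i, 0 ≤ c i := fun i => div_nonneg (hE.nonneg i) (sq_nonneg _)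
  let ν : ℕ → Measure ℝ := fun i => (chiSq 1).map (fun z => c i * lam i * z)
  have hνp : ∀ i, IsProbabilityMeasure (ν i) := fun i =>
    Measure.isProbabilityMeasure_map (by fun_prop)
  -- Without penalty the weight is `1 / lam i`, which cancels the variance.
  have hνk : ∀ i < k, ν i = chiSq 1 := by
    intro i hi
    obtain ⟨δ, hδ, h⟩ := hk.exists_pos hE.antitone
    have h1 := h i hi
    have h2 := hE.nonneg k
    have : c i * lam i = 1 := by
      have : lam i ≠ 0 := by linarith
      simp only [hc, if_pos hi, add_zero]
      field_simp
    simp only [ν, this, one_mul, Measure.map_id']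
  have hνt : ∀ i, c (k + i) * lam (k + i) = lam (k + i) ^ 2 / (lam (k + i) + α) ^ 2 := by
    intro i
    simp only [hc, if_neg (not_lt.2 (Nat.le_add_right k i))]
    ring
  have hx : ∀ i, AEMeasurable (fun ω => ⟪ζ i, X ω⟫) P := fun i =>
    (hX.map_fun (innerSL ℝ (ζ i))).aemeasurable
  have hvm : ∀ i, AEMeasurable (v i) P := fun i => ((hx i).pow_const 2).const_mul _
  have hvlaw : ∀ i, P.map (v i) = ν i := by
    intro i
    change _ = (chiSq 1).map (fun z => c i * lam i * z)
    rw [← map_mul_sq_gaussianReal (hE.nonneg i), ← map_inner_eigenvector hX hm hC hE i,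
      AEMeasurable.map_map_of_aemeasurable (by fun_prop) (hx i)]
    rfl
  have hvind : iIndepFun v P :=
    (iIndepFun_inner_eigenvector hX hm hC hE).comp (fun i z => c i * z ^ 2)
      fun i => by fun_prop
  have hvm' : AEMeasurable (fun ω i => v i ω) P := aemeasurable_pi_iff.2 hvm
  have hLm : AEMeasurable (fun ω => (∑ i ∈ Finset.range k, v i ω, fun i => v (k + i) ω)) P :=
    (show Measurable fun w : ℕ → ℝ => (∑ i ∈ Finset.range k, w i, fun i => w (k + i)) by
      fun_prop).comp_aemeasurable hvm'
  have hL : P.map (fun ω => (∑ i ∈ Finset.range k, v i ω, fun i => v (k + i) ω))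
      = (chiSq k).prod (Measure.infinitePi fun i => ν (k + i)) := by
    rw [← infinitePi_map_sum_range_prod_tail ν k hνk]
    have h1 : P.map (fun ω i => v i ω) = Measure.infinitePi ν := by
      rw [hvind.map_fun_eq_infinitePi_map₀ hvm']
      simp_rw [hvlaw]
    rw [← h1, AEMeasurable.map_map_of_aemeasurable (by fun_prop) hvm']
    rfl
  set u : ℕ → Ω' → ℝ := fun i ω' => lam (k + i) ^ 2 / (lam (k + i) + α) ^ 2 * η (k + i) ω' with hu
  have hηm : ∀ i, AEMeasurable (η i) P' := fun i => (hη i).aemeasurable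
  have hum : AEMeasurable (fun ω' i => u i ω') P' :=
    aemeasurable_pi_iff.2 fun i => (hηm _).const_mul _
  have huind : iIndepFun u P' :=
    (hη_indep.precomp (add_right_injective k)).comp
      (fun i z => lam (k + i) ^ 2 / (lam (k + i) + α) ^ 2 * z) fun i => by fun_prop
  have hulaw : P'.map (fun ω' i => u i ω') = Measure.infinitePi fun i => ν (k + i) := by
    rw [huind.map_fun_eq_infinitePi_map₀ hum]
    congr 1
    ext1 i
    simp only [ν, hνt, ← (hη (k + i)).map_eq]
    rw [AEMeasurable.map_map_of_aemeasurable (by fun_prop) (hηm _)]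
    rfl
  have hyu : IndepFun y (fun ω' i => u i ω') P' :=
    hyη_indep.comp (φ := id)
      (ψ := fun (w : ℕ → ℝ) i => lam (k + i) ^ 2 / (lam (k + i) + α) ^ 2 * w (k + i))
      measurable_id (by fun_prop)
  have hR : P'.map (fun ω' => (y ω', fun i => u i ω'))
      = (chiSq k).prod (Measure.infinitePi fun i => ν (k + i)) := by
    rw [(indepFun_iff_map_prod_eq_prod_map_map hy.aemeasurable hum).1 hyu, hy.map_eq, hulaw]
  -- Equality in law is established for the pair in `ℝ × (ℕ → ℝ)`, since both the sum and
  -- summability are measurable functions of it.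
  have hid : IdentDistrib (fun ω => (∑ i ∈ Finset.range k, v i ω, fun i => v (k + i) ω))
      (fun ω' => (y ω', fun i => u i ω')) P P' :=
    ⟨hLm, hy.aemeasurable.prodMk hum, hL.trans hR.symm⟩
  have hsum : ∀ ω, HasSum (fun i => v i ω) (rdmdSq α k (X ω) 0 C) := fun ω => by
    simpa only [sub_zero] using hE.hasSum_rdmdSq hα hk (X ω) 0
  have hvM : ∀ ω, (fun i => v (k + i) ω) ∈ nonnegSummable := fun ω =>
    ⟨fun i => mul_nonneg (hc0 _) (sq_nonneg _),
      (hsum ω).summable.comp_injective (add_right_injective k)⟩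
  -- On `Ω` the series converges for every `ω`, being the expansion of the distance; equality in law
  -- carries this over to the series in `η`.
  have huM : ∀ᵐ ω' ∂P', (fun i => u i ω') ∈ nonnegSummable := by
    have hS : MeasurableSet (Prod.snd ⁻¹' nonnegSummable : Set (ℝ × (ℕ → ℝ))) :=
      measurable_snd measurableSet_nonnegSummable
    exact hid.ae_snd (p := fun q => q.2 ∈ nonnegSummable) hS (Eventually.of_forall hvM)
  refine ⟨huM.mono fun ω' h => h.2, ?_⟩
  have hF : Measurable fun q : ℝ × (ℕ → ℝ) => q.1 + (ennrealSum q.2).toReal :=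
    measurable_fst.add (measurable_ennrealSum.comp measurable_snd).ennreal_toReal
  have hfin := hid.comp hF
  have e1 : (fun q : ℝ × (ℕ → ℝ) => q.1 + (ennrealSum q.2).toReal) ∘
      (fun ω => (∑ i ∈ Finset.range k, v i ω, fun i => v (k + i) ω))
      = fun ω => rdmdSq α k (X ω) 0 C := by
    ext ω
    simp only [Function.comp_apply]
    rw [toReal_ennrealSum (hvM ω), ← (hsum ω).tsum_eq, ← (hsum ω).summable.sum_add_tsum_nat_add k]
    simp only [add_comm]
  rw [e1] at hfin
  refine hfin.trans (IdentDistrib.of_ae_eq hfin.aemeasurable_snd ?_)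
  filter_upwards [huM] with ω' h
  simp only [Function.comp_apply]
  rw [toReal_ennrealSum h]

end Law

/-! ### Transfer from `L²(I)` to the Bayes space. -/

namespace BayesSpace

variable {a b : ℝ}

instance : SecondCountableTopology (BayesSpace a b) :=
  have : Fact ((2 : ℝ≥0∞) ≠ ∞) := ⟨by simp⟩
  (clrₗᵢ a b).isometry.isEmbedding.secondCountableTopology

/-- The adjoint of the isometry `clr` is a left inverse, so `X` is a continuous linear image of `clr
X`. -/
lemma hasGaussianLaw_of_clr {Ω : Type*} [MeasurableSpace Ω] {P : Measure Ω}
    {X : Ω → BayesSpace a b} (h : HasGaussianLaw (fun ω => clr (X ω)) P) :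
    HasGaussianLaw X P := by
  have h' := h.map_fun (ContinuousLinearMap.adjoint (clrₗᵢ a b).toContinuousLinearMap)
  refine h'.congr (ae_of_all _ fun ω => ?_)
  exact (congrArg (fun T : BayesSpace a b →L[ℝ] BayesSpace a b => T (X ω))
    (LinearIsometry.adjoint_comp_self (clrₗᵢ a b)))

end BayesSpace

end BayesRDMD

theorem corollary2 {a b : ℝ} (hab : a < b)
    {Ω : Type*} [MeasurableSpace Ω] (P : MeasureTheory.Measure Ω)
    [MeasureTheory.IsProbabilityMeasure P]
    -- the random density, with Gaussian clr transform, constant mean and covariance `C`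
    (X : Ω → BayesRDMD.BayesSpace a b) (hX : AEMeasurable X P)
    (hgauss : ProbabilityTheory.HasGaussianLaw (fun ω => BayesRDMD.BayesSpace.clr (X ω)) P)
    (hmean : BayesRDMD.IsMean P X 0)
    (C : BayesRDMD.BayesSpace a b →L[ℝ] BayesRDMD.BayesSpace a b)
    (hC : BayesRDMD.IsCovariance P X 0 C)
    -- the eigenpairs of `C`
    (lam : ℕ → ℝ) (ζ : ℕ → BayesRDMD.BayesSpace a b) (heig : BayesRDMD.IsEigenSystem C lam ζ)
    -- strongly consistent estimators of the mean and of the covariance operator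
    (muHat : ℕ → Ω → BayesRDMD.BayesSpace a b) (hmu_meas : ∀ n, AEMeasurable (muHat n) P)
    (hmu : BayesRDMD.StronglyConsistent P muHat 0)
    (CHat : ℕ → Ω → (BayesRDMD.BayesSpace a b →L[ℝ] BayesRDMD.BayesSpace a b))
    (hCHat_meas : ∀ n, MeasureTheory.AEStronglyMeasurable (CHat n) P)
    (hCHat_cov : ∀ n, ∀ᵐ ω ∂P, (CHat n ω).IsPositive ∧ IsCompactOperator (CHat n ω))
    (hCHat : BayesRDMD.StronglyConsistent P CHat C)
    -- the regularization parameters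
    (α : ℝ) (hα : 0 < α) (k : ℕ) (hk : BayesRDMD.SpectralGap lam k)
    -- the chi-squared variables of the limiting law; `η i` belongs to the eigenvalue `lam i`
    {Ω' : Type*} [MeasurableSpace Ω'] (P' : MeasureTheory.Measure Ω')
    [MeasureTheory.IsProbabilityMeasure P']
    (y : Ω' → ℝ) (η : ℕ → Ω' → ℝ)
    (hy : ProbabilityTheory.HasLaw y (BayesRDMD.chiSq k) P')
    (hη : ∀ i, ProbabilityTheory.HasLaw (η i) (BayesRDMD.chiSq 1) P')
    (hη_indep : ProbabilityTheory.iIndepFun η P')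
    (hyη_indep : ProbabilityTheory.IndepFun y (fun ω' i => η i ω') P') :
    MeasureTheory.TendstoInDistribution
      (fun n ω => BayesRDMD.rdmdSq α k (X ω) (muHat n ω) (CHat n ω)) Filter.atTop
      (fun ω => BayesRDMD.rdmdSq α k (X ω) 0 C) (fun _ => P) P ∧
    (∀ᵐ ω' ∂P', Summable fun i : ℕ =>
      lam (k + i) ^ 2 / (lam (k + i) + α) ^ 2 * η (k + i) ω') ∧
    ProbabilityTheory.IdentDistrib
      (fun ω => BayesRDMD.rdmdSq α k (X ω) 0 C)
      (fun ω' => y ω' + ∑' i : ℕ,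
        lam (k + i) ^ 2 / (lam (k + i) + α) ^ 2 * η (k + i) ω') P P' := by
  have hX' := BayesRDMD.BayesSpace.hasGaussianLaw_of_clr hgauss
  exact ⟨BayesRDMD.tendstoInDistribution_rdmdSq hα heig hk hX hmu_meas hmu hCHat_meas hCHat_cov
    hCHat, BayesRDMD.identDistrib_rdmdSq hX' hmean hC heig hα hk hy hη hη_indep hyη_indep⟩
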